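/- Let $(\mathcal M,g)$ be a complete, connected, smooth Riemannian manifold without boundary, with Riemannian measure $dM$, and let $X_t,\widehat X_t$ ($t\in[0,1]$) be $\mathcal M$-valued stochastic processes with time-marginal probability densities $\rho(t,\cdot),\hat\rho(t,\cdot)$ with respect to $dM$. Suppose that $\rho,\hat\rho$ are strictly positive on $[0,1]\times\mathcal M$, of class $C^1$ in $x$ at each time, and differentiable in $t$ with $\partial_t\rho,\partial_t\hat\rho$ continuous on $[0,1]\times\mathcal M$. Let $v(t,\cdot),\hat v(t,\cdot)$ be continuous vector fields on $\mathcal M$ for $t\in[0,1]$ with $$\int_0^1\!\!\int_{\mathcal M}|v|_g\,\rho\,dM\,dt<\infty,\qquad \int_0^1\!\!\int_{\mathcal M}|\hat v|_g\,\hat\rho\,dM\,dt<\infty,$$ such that for every $t\in[0,1]$ the transport equations $$\partial_t\rho+\mathbf{div}[\rho\,v]=0,\qquad \partial_t\hat\rho+\mathbf{div}[\hat\rho\,\hat v]=0$$ hold on $\mathcal M$, where $\mathbf{div}\,Y=D$ means that $\int_{\mathcal M} D f\,dM=-\int_{\mathcal M} Y(f)\,dM$ for all $f\in C_c^\infty(\mathcal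 M)$ (the pointwise equation when $Y$ is $C^1$). Let $s=\nabla\log\rho$ and $\hat s=\nabla\log\hat\rho$ be the score fields and suppose that $\langle s-\hat s,v-\hat v\rangle_g\,\rho$ is integrable on $[0,1]\times\mathcal M$. If $X_0$ and $\widehat X_0$ have the same distribution, then the Kullback--Leibler divergence of the law $\rho_1$ of $X_1$ from the law $\hat\rho_1$ of $\widehat X_1$ is finite and $$\mathrm{KL}(\rho_1\,\|\,\hat\rho_1)=\int_0^1\int_{\mathcal M}\langle s-\hat s,\,v-\hat v\rangle_g\,\rho(t,x)\,dM(x)\,dt .$$ -/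

import Mathlib

open MeasureTheory Set Bundle
open scoped Manifold ContDiff

namespace RiemKL

noncomputable section

section Geometry

variable {d : ℕ} {M : Type*} [TopologicalSpace M] [ChartedSpace (EuclideanSpace ℝ (Fin d)) M]
  [RiemannianBundle (fun x : M => TangentSpace (𝓡 d) x)]

/-- The Riemannian gradient `∇ f`, defined by `⟨∇ f, w⟩_g = df(w)` for all tangent vectors `w`:
the Riesz representative of the differential in the tangent space with its inner product `g`. -/
def grad (f : M → ℝ) (x : M) : TangentSpace (𝓡 d) x :=
  haveI : FiniteDimensional ℝ (TangentSpace (𝓡 d) x) :=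
    inferInstanceAs (FiniteDimensional ℝ (EuclideanSpace ℝ (Fin d)))
  haveI : CompleteSpace (TangentSpace (𝓡 d) x) := FiniteDimensional.complete ℝ _
  (InnerProductSpace.toDual ℝ (TangentSpace (𝓡 d) x)).symm
    (mfderiv (𝓡 d) 𝓘(ℝ, ℝ) f x : TangentSpace (𝓡 d) x →L[ℝ] ℝ)

/-- The defining property of the Riemannian gradient. -/
theorem inner_grad (f : M → ℝ) (x : M) (w : TangentSpace (𝓡 d) x) :
    inner ℝ (grad (d := d) f x) w = (mfderiv (𝓡 d) 𝓘(ℝ, ℝ) f x w : ℝ) := by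
  have : FiniteDimensional ℝ (TangentSpace (𝓡 d) x) :=
    inferInstanceAs (FiniteDimensional ℝ (EuclideanSpace ℝ (Fin d)))
  have : CompleteSpace (TangentSpace (𝓡 d) x) := FiniteDimensional.complete ℝ _
  exact InnerProductSpace.toDual_symm_apply

/-- The `i`-th coordinate vector field `∂_i` of the chart around `c`, at the point of `M` with
coordinates `u`. -/
def coordVec (c : M) (i : Fin d) (u : EuclideanSpace ℝ (Fin d)) :
    TangentSpace (𝓡 d) ((extChartAt (𝓡 d) c).symm u) :=
  mfderiv 𝓘(ℝ, EuclideanSpace ℝ (Fin d)) (𝓡 d) (extChartAt (𝓡 d) c).symm u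
    (EuclideanSpace.single i (1 : ℝ) : EuclideanSpace ℝ (Fin d))

/-- The matrix `G = (g_ij)` of the metric in the chart around `c`, as a function of the
coordinates `u`. -/
def metricMatrix (c : M) (u : EuclideanSpace ℝ (Fin d)) : Matrix (Fin d) (Fin d) ℝ :=
  Matrix.of fun i j => inner ℝ (coordVec c i u) (coordVec c j u)

variable [IsManifold (𝓡 d) ∞ M]

/-- The Riemannian measure of the domain `U` of the chart `φ` around `c`, extended by zero:
`∫ f = ∫_{φ(U)} (f ∘ φ⁻¹) √|det G| du`. -/
def chartVolume [MeasurableSpace M] (c : M) : Measure M :=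
  Measure.map (extChartAt (𝓡 d) c).symm
    (((volume : Measure (EuclideanSpace ℝ (Fin d))).restrict
        (extChartAt (𝓡 d) c).target).withDensity
      fun u => ENNReal.ofReal (Real.sqrt |(metricMatrix c u).det|))

variable (d M) in
/-- A smooth partition of unity subordinate to the domains of the charts. -/
def chartPartition [T2Space M] [SigmaCompactSpace M] :
    SmoothPartitionOfUnity M (𝓡 d) M univ :=
  (SmoothPartitionOfUnity.exists_isSubordinate_chartAt_source (𝓡 d) M).choose

variable (d M) in
/-- The Riemannian measure of `M`: the local measures `√|det G| du` patched together with a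
partition of unity `(ψ_c)` subordinate to the charts, `∫ f dM = ∑_c ∫ ψ_c f d(chartVolume c)`
(which does not depend on the partition of unity, by the change of variables formula). -/
def riemVolume [T2Space M] [SigmaCompactSpace M] [MeasurableSpace M] : Measure M :=
  Measure.sum fun c : M =>
    (chartVolume (d := d) c).withDensity fun x => ENNReal.ofReal (chartPartition d M c x)

/-- `div Y = D` on `M`, the divergence being defined by the Stokes formula
`∫ (div Y) f dM = - ∫ Y(f) dM` for all smooth compactly supported `f`. For a `C¹` vector field
`Y` and a continuous function `D` this is the pointwise identity; for a continuous
vector field it is the identity in the sense of distributions. -/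
def HasDivergence [T2Space M] [SigmaCompactSpace M] [MeasurableSpace M]
    (Y : (x : M) → TangentSpace (𝓡 d) x) (D : M → ℝ) : Prop :=
  ∀ f : M → ℝ, ContMDiff (𝓡 d) 𝓘(ℝ, ℝ) ∞ f → HasCompactSupport f →
    ∫ x, D x * f x ∂(riemVolume d M) =
      - ∫ x, (mfderiv (𝓡 d) 𝓘(ℝ, ℝ) f x (Y x) : ℝ) ∂(riemVolume d M)

/-- The time derivative `∂_t ρ` on the time interval `[0,1]` (one-sided at `0` and `1`). -/
def timeDeriv (ρ : ℝ → M → ℝ) (t : ℝ) (x : M) : ℝ :=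
  derivWithin (fun τ => ρ τ x) (Icc 0 1) t

/-- Regular, strictly positive densities on `[0,1] × M`: `C¹` in the space variable at each time,
and differentiable in time with a time derivative that is continuous on `[0,1] × M`. -/
structure IsRegularDensity (ρ : ℝ → M → ℝ) : Prop where
  pos : ∀ t ∈ Icc (0 : ℝ) 1, ∀ x, 0 < ρ t x
  contMDiff : ∀ t ∈ Icc (0 : ℝ) 1, ContMDiff (𝓡 d) 𝓘(ℝ, ℝ) 1 (ρ t)
  differentiableOn : ∀ x, DifferentiableOn ℝ (fun t => ρ t x) (Icc 0 1)
  continuousOn_timeDeriv :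
    ContinuousOn (fun p : ℝ × M => timeDeriv ρ p.1 p.2) (Icc 0 1 ×ˢ univ)

/-- The transport equation `∂_t ρ + div (ρ v) = 0` on `[0,1] × M`: at every time `t ∈ [0,1]`,
`div (ρ_t v_t) = - ∂_t ρ_t`. -/
def SolvesTransport [T2Space M] [SigmaCompactSpace M] [MeasurableSpace M]
    (ρ : ℝ → M → ℝ) (v : ℝ → (x : M) → TangentSpace (𝓡 d) x) : Prop :=
  ∀ t ∈ Icc (0 : ℝ) 1,
    HasDivergence (fun x => ρ t x • v t x) (fun x => - timeDeriv ρ t x)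

/-- `v` is a time-dependent (continuous) vector field on `M`, for times in `[0,1]`. -/
def IsTimeVectorField (v : ℝ → (x : M) → TangentSpace (𝓡 d) x) : Prop :=
  ∀ t ∈ Icc (0 : ℝ) 1,
    Continuous (fun x : M => (⟨x, v t x⟩ : TotalSpace (EuclideanSpace ℝ (Fin d))
      (fun x : M => TangentSpace (𝓡 d) x)))

/-- The integrability condition `∫₀¹ ∫_M |v| ρ dM dt < ∞`. -/
def FiniteFlux [T2Space M] [SigmaCompactSpace M] [MeasurableSpace M]
    (ρ : ℝ → M → ℝ) (v : ℝ → (x : M) → TangentSpace (𝓡 d) x) : Prop :=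
  IntegrableOn (fun p : ℝ × M => ‖v p.1 p.2‖ * ρ p.1 p.2) (Icc 0 1 ×ˢ univ)
    ((volume : Measure ℝ).prod (riemVolume d M))

/-- The score field `s = ∇ log ρ`. -/
def score (ρ : ℝ → M → ℝ) (t : ℝ) (x : M) : TangentSpace (𝓡 d) x :=
  grad (fun y => Real.log (ρ t y)) x

/-- The integrand `⟨s - ŝ, v - v̂⟩_g ρ`. -/
def klIntegrand (ρ ρ' : ℝ → M → ℝ) (v v' : ℝ → (x : M) → TangentSpace (𝓡 d) x)
    (t : ℝ) (x : M) : ℝ :=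
  inner ℝ (score (d := d) ρ t x - score (d := d) ρ' t x) (v t x - v' t x) * ρ t x

variable (d) in
/-- `ρ` is the time-marginal probability density (with respect to the Riemannian measure) of the
stochastic process `X` on `M` with time interval `[0,1]`. -/
def IsMarginalDensity [T2Space M] [SigmaCompactSpace M] [MeasurableSpace M]
    {Ω : Type*} [MeasurableSpace Ω] (ℙ : Measure Ω) (X : ℝ → Ω → M) (ρ : ℝ → M → ℝ) : Prop :=
  ∀ t ∈ Icc (0 : ℝ) 1, AEMeasurable (X t) ℙ ∧
    ℙ.map (X t) = (riemVolume d M).withDensity fun x => ENNReal.ofReal (ρ t x)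

end Geometry

end

end RiemKL

/-! Put `z = log (ρ / ρ')`. The entropy density `ρ z + ρ' (1 - e^z)` has time derivative `∂_tρ z +
∂_tρ' (1 - e^z)`, because the two terms containing `∂_t z` cancel by `ρ' e^z = ρ`. Testing the
transport equations against `z` and `1 - e^z` turns its integral into `∫ ρ (v(z) - v'(z)) dM`, and
`dz = ⟨s - s', ·⟩`, so this is the claimed integrand. At time `0` the entropy vanishes; integrate in
time.

Three obstacles make this formal. Firstly, `z` and `e^z` are unbounded. They are replaced by
`truncLog n` and `truncExp n`, the primitives of `η_n` and `-η_n e^s` for a cutoff `η_n`; the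
cancellation survives (`hasDerivWithinAt_truncEntropy`) and the integrand is only multiplied by
`η_n(z)`. The truncated entropies are nonnegative and increase with `n` to the entropy
(`monotone_truncKL`), so monotone convergence on the left and domination on the right give both
finiteness and the formula.

Secondly, test functions must have compact support. By Hopf-Rinow, completeness makes balls compact,
so smoothed functions of the distance give cutoffs `χ_k → 1` with `|dχ_k| ≤ 5/(k+1)`
(`exists_smooth_cutoffs`). The error they create is at most a multiple of `1/(k+1)` times the total
flux, which is finite.

Thirdly, the test functions are only `C¹`. They are approximated in `C¹` by smooth ones
(`HasDivergence.integral_eq`). This approximation and the smoothing of the distance share one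
argument: mollify in charts (`exists_contDiff_approx`), then glue with a partition of unity
(`exists_contMDiff_approx`). -/

namespace RiemKL

open Filter Topology Metric

/-! ### Complete locally compact length spaces are proper. -/

section HopfRinow

/-- Approximate midpoints at every ratio: the metric form of being a length space. -/
def HasApproxGeodesics (X : Type*) [PseudoMetricSpace X] : Prop :=
  ∀ x y : X, ∀ s, 0 ≤ s → s ≤ dist x y → ∀ ε > 0,
    ∃ z, dist x z = s ∧ dist z y ≤ dist x y - s + ε

variable {X : Type*} [MetricSpace X]

/-- Stopping an almost-geodesic from the centre slightly early shows that the ball lies close to a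
smaller, compact ball, whose finite nets are then nets for it too. -/
theorem HasApproxGeodesics.isCompact_closedBall_of_lt [CompleteSpace X]
    (h : HasApproxGeodesics X) {x : X} {R : ℝ} (hR : 0 < R)
    (hc : ∀ s < R, IsCompact (closedBall x s)) : IsCompact (closedBall x R) := by
  rw [isCompact_iff_totallyBounded_isComplete]
  refine ⟨Metric.totallyBounded_iff.2 fun ε hε => ?_, isClosed_closedBall.isComplete⟩
  set s := max (R - ε / 3) 0 with hs
  have hsR : s < R := max_lt (by linarith) hR
  have hRs : R - s ≤ ε / 3 := by linarith [le_max_left (R - ε / 3) 0]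
  have hs0 : 0 ≤ s := le_max_right _ _
  obtain ⟨t, ht, htc⟩ := Metric.totallyBounded_iff.1 (hc s hsR).totallyBounded (ε / 3) (by linarith)
  refine ⟨t, ht, fun y hy => ?_⟩
  rw [mem_closedBall, dist_comm] at hy
  obtain ⟨z, hz, hzy⟩ := h x y (min s (dist x y)) (le_min hs0 dist_nonneg) (min_le_right _ _)
    (ε / 6) (by linarith)
  have hz' : z ∈ closedBall x s := by
    rw [mem_closedBall, dist_comm, hz]; exact min_le_left _ _
  have := htc hz'
  simp only [mem_iUnion, mem_ball, exists_prop] at this ⊢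
  obtain ⟨w, hw, hzw⟩ := this
  refine ⟨w, hw, ?_⟩
  have h1 : dist x y - min s (dist x y) ≤ ε / 3 := by
    rcases min_cases s (dist x y) with ⟨h, _⟩ | ⟨h, _⟩ <;> rw [h] <;> linarith
  linarith [dist_triangle y z w, dist_comm y z]

/-- A slightly larger ball lies in a thin thickening of the compact one, hence in a compact
neighbourhood of it. -/
theorem HasApproxGeodesics.exists_isCompact_closedBall_add [LocallyCompactSpace X]
    (h : HasApproxGeodesics X) {x : X} {R : ℝ} (hR : 0 ≤ R)
    (hc : IsCompact (closedBall x R)) : ∃ δ > 0, IsCompact (closedBall x (R + δ)) := by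
  obtain ⟨K, hK, hRK⟩ := exists_compact_superset hc
  obtain ⟨δ, hδ, hδK⟩ := hc.exists_thickening_subset_open isOpen_interior hRK
  refine ⟨δ / 3, by linarith, hK.of_isClosed_subset isClosed_closedBall fun y hy => ?_⟩
  refine interior_subset (hδK ?_)
  rw [mem_closedBall, dist_comm] at hy
  obtain ⟨z, hz, hzy⟩ := h x y (min R (dist x y)) (le_min hR dist_nonneg) (min_le_right _ _)
    (δ / 3) (by linarith)
  refine mem_thickening_iff.2 ⟨z, ?_, ?_⟩
  · rw [mem_closedBall, dist_comm, hz]; exact min_le_left _ _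
  · have h1 : dist x y - min R (dist x y) ≤ δ / 3 := by
      rcases min_cases R (dist x y) with ⟨h, _⟩ | ⟨h, _⟩ <;> rw [h] <;> linarith
    rw [dist_comm]; linarith

/-- The Hopf-Rinow-Cohn-Vossen theorem: a complete locally compact length space is proper. -/
theorem HasApproxGeodesics.properSpace [CompleteSpace X] [LocallyCompactSpace X]
    (h : HasApproxGeodesics X) : ProperSpace X := by
  refine ⟨fun x r => ?_⟩
  by_contra hr
  -- The set of compact radii is bounded if one ball fails; its supremum belongs to it by the first
  -- lemma and is exceeded by the second.
  set S := {s : ℝ | IsCompact (closedBall x s)}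
  have hdown : ∀ s ∈ S, ∀ s' ≤ s, s' ∈ S := fun s hs s' hs' =>
    IsCompact.of_isClosed_subset hs isClosed_closedBall (closedBall_subset_closedBall hs')
  have hbdd : BddAbove S := ⟨r, fun s hs => by
    by_contra hlt
    exact hr (hdown s hs r (not_le.1 hlt).le)⟩
  have h0 : (0 : ℝ) ∈ S := by simp [S]
  obtain ⟨δ, hδ, hδS⟩ := h.exists_isCompact_closedBall_add le_rfl h0
  have hpos : 0 < sSup S := lt_of_lt_of_le (by linarith) (le_csSup hbdd hδS)
  have hR : IsCompact (closedBall x (sSup S)) := by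
    refine h.isCompact_closedBall_of_lt hpos fun s hs => ?_
    obtain ⟨s', hs', hlt⟩ := exists_lt_of_lt_csSup ⟨0, h0⟩ hs
    exact hdown s' hs' s hlt.le
  obtain ⟨δ', hδ', hδS'⟩ := h.exists_isCompact_closedBall_add hpos.le hR
  linarith [le_csSup hbdd hδS']

end HopfRinow

/-! ### Riemannian manifolds are length spaces. -/

section

variable {d : ℕ} {M : Type*} [MetricSpace M]
    [ChartedSpace (EuclideanSpace ℝ (Fin d)) M]
    [RiemannianBundle (fun x : M => TangentSpace (𝓡 d) x)]

variable (d M) in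
-- Take a curve of length below `dist x y + ε` and cut it, by the intermediate value theorem, at
-- distance `s` from `x`. The first piece has length at least `s`, so the rest is short.
theorem hasApproxGeodesics_of_isRiemannianManifold [IsRiemannianManifold (𝓡 d) M] :
    HasApproxGeodesics M := by
  intro x y s hs hsd ε hε
  have hlt : Manifold.riemannianEDist (𝓡 d) x y < ENNReal.ofReal (dist x y + ε) := by
    rw [← IsRiemannianManifold.out (I := 𝓡 d) x y, edist_dist]
    exact (ENNReal.ofReal_lt_ofReal_iff (by positivity)).2 (by linarith)
  obtain ⟨γ, h0, h1, hγ, hlen⟩ := Manifold.exists_lt_of_riemannianEDist_lt hlt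
  have hcont : ContinuousOn (fun t => dist x (γ t)) (Icc 0 1) :=
    (continuous_const.dist continuous_id).comp_continuousOn hγ.continuousOn
  have hmem : s ∈ Icc (dist x (γ 0)) (dist x (γ 1)) := by rw [h0, h1, dist_self]; exact ⟨hs, hsd⟩
  obtain ⟨t, ht, hts⟩ := intermediate_value_Icc zero_le_one hcont hmem
  refine ⟨γ t, hts, ?_⟩
  have e1 : edist x (γ t) ≤ Manifold.pathELength (𝓡 d) γ 0 t := by
    rw [IsRiemannianManifold.out (I := 𝓡 d) x]
    exact Manifold.riemannianEDist_le_pathELength (hγ.mono (Icc_subset_Icc le_rfl ht.2)) h0 rfl ht.1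
  have e2 : edist (γ t) y ≤ Manifold.pathELength (𝓡 d) γ t 1 := by
    rw [IsRiemannianManifold.out (I := 𝓡 d) _ y]
    exact Manifold.riemannianEDist_le_pathELength (hγ.mono (Icc_subset_Icc ht.1 le_rfl)) rfl h1 ht.2
  have e3 := (add_le_add e1 e2).trans
    ((Manifold.pathELength_add (I := 𝓡 d) ht.1 ht.2).le.trans hlen.le)
  rw [edist_dist, edist_dist, ← ENNReal.ofReal_add dist_nonneg dist_nonneg,
    ENNReal.ofReal_le_ofReal_iff (by positivity)] at e3
  simp only at hts
  linarith

end

/-! ### Mollification in a Euclidean space. -/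

section Mollify

variable {E : Type*} [NormedAddCommGroup E] [InnerProductSpace ℝ E]

/-- Apply the bound to `u + t w` and `u`, divide by `|t|` and let `t → 0`. Only the homogeneity of
`p` matters, which covers `C¹` functions (`p = ε‖·‖`) and Lipschitz functions (`ℓ = 0`) alike. -/
theorem abs_fderiv_sub_le_of_forall_abs_sub_le {F : E → ℝ} {u : E} (hF : DifferentiableAt ℝ F u)
    {ℓ : E →L[ℝ] ℝ} {p : E → ℝ} (hp : ∀ (t : ℝ) w, p (t • w) = |t| * p w) {s : Set E}
    (hs : IsOpen s) (h : ∀ a ∈ s, ∀ b ∈ s, |F a - F b - ℓ (a - b)| ≤ p (a - b))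
    (hu : u ∈ s) (w : E) : |fderiv ℝ F u w - ℓ w| ≤ p w := by
  have h1 := hF.hasFDerivAt.hasLineDerivAt w
  have h2 : Tendsto (fun t : ℝ => |t⁻¹ • (F (u + t • w) - F u) - ℓ w|) (𝓝[≠] 0)
      (𝓝 |fderiv ℝ F u w - ℓ w|) := (h1.tendsto_slope_zero.sub_const _).abs
  refine le_of_tendsto h2 ?_
  have h3 : ∀ᶠ t : ℝ in 𝓝[≠] 0, u + t • w ∈ s := by
    have : Tendsto (fun t : ℝ => u + t • w) (𝓝 0) (𝓝 u) := by
      have : Continuous (fun t : ℝ => u + t • w) := by fun_prop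
      simpa using this.tendsto 0
    exact (this.mono_left nhdsWithin_le_nhds).eventually (hs.mem_nhds hu)
  filter_upwards [h3, self_mem_nhdsWithin] with t ht ht0
  have ht0 : t ≠ 0 := ht0
  have h4 := h _ ht _ hu
  rw [add_sub_cancel_left, hp, map_smul, smul_eq_mul] at h4
  have h5 : t⁻¹ • (F (u + t • w) - F u) - ℓ w = t⁻¹ * (F (u + t • w) - F u - t * ℓ w) := by
    rw [smul_eq_mul]; field_simp
  rw [h5, abs_mul, abs_inv, inv_mul_le_iff₀ (abs_pos.2 ht0)]
  exact h4

/-- The two-point bound passes to averages of translates, hence to a convolution with a bump, where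
it becomes a bound on the derivative. -/
theorem exists_contDiff_approx [FiniteDimensional ℝ E] {G : E → ℝ} (hG : Continuous G) (hGc : HasCompactSupport G)
    {ℓ : E →L[ℝ] ℝ} {p : E → ℝ} (hp : ∀ (t : ℝ) w, p (t • w) = |t| * p w)
    {u₀ : E} {δ : ℝ} (hδ : 0 < δ)
    (h : ∀ a ∈ ball u₀ δ, ∀ b ∈ ball u₀ δ, |G a - G b - ℓ (a - b)| ≤ p (a - b))
    {ε : ℝ} (hε : 0 < ε) :
    ∃ F : E → ℝ, ContDiff ℝ ∞ F ∧ (∀ u, |F u - G u| ≤ ε) ∧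
      ∀ u ∈ ball u₀ (δ / 2), ∀ w, |fderiv ℝ F u w - ℓ w| ≤ p w := by
  borelize E
  have hGu : UniformContinuous G := hGc.uniformContinuous_of_continuous hG
  obtain ⟨η, hη, hGη⟩ := Metric.uniformContinuous_iff.1 hGu ε hε
  -- Radius below `η` gives uniform closeness; radius below `δ / 2` keeps the translates of the half
  -- ball inside the ball of radius `δ`.
  let φ : ContDiffBump (0 : E) :=
    ⟨min η (δ / 2) / 2, min η (δ / 2), by positivity, by
      have : 0 < min η (δ / 2) := by positivity
      linarith⟩
  let μ : Measure E := volume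
  let F : E → ℝ := convolution (φ.normed μ) G (ContinuousLinearMap.lsmul ℝ ℝ) μ
  have hF : ContDiff ℝ ∞ F := by
    refine HasCompactSupport.contDiff_convolution_left _ φ.hasCompactSupport_normed
      φ.contDiff_normed hG.locallyIntegrable
  refine ⟨F, hF, fun u => ?_, fun u hu w => ?_⟩
  · refine ContDiffBump.dist_normed_convolution_le hG.aestronglyMeasurable fun x hx => ?_
    refine (hGη ?_).le
    exact lt_of_lt_of_le hx (min_le_left _ _)
  · refine abs_fderiv_sub_le_of_forall_abs_sub_le (hF.differentiable (by simp) u) hp isOpen_ball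
      (fun a ha b hb => ?_) hu w
    have hint : ∀ c, Integrable (fun t => φ.normed μ t * G (c - t)) μ := fun c =>
      (φ.continuous_normed.mul (hG.comp (by fun_prop))).integrable_of_hasCompactSupport
        φ.hasCompactSupport_normed.mul_right
    have hint' : Integrable (fun t => φ.normed μ t) μ := φ.integrable_normed
    have e1 : F a - F b - ℓ (a - b) =
        ∫ t, φ.normed μ t * (G (a - t) - G (b - t) - ℓ (a - b)) ∂μ := by
      have : ∀ t, φ.normed μ t * (G (a - t) - G (b - t) - ℓ (a - b)) =
          φ.normed μ t * G (a - t) - φ.normed μ t * G (b - t) - φ.normed μ t * ℓ (a - b) :=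
        fun t => by ring
      simp_rw [this]
      rw [integral_sub (by exact (hint a).sub (hint b)) (hint'.mul_const _), integral_sub (hint a) (hint b),
        integral_mul_const, φ.integral_normed, one_mul]
      rfl
    rw [e1, ← Real.norm_eq_abs]
    calc ‖∫ t, φ.normed μ t * (G (a - t) - G (b - t) - ℓ (a - b)) ∂μ‖
        ≤ ∫ t, φ.normed μ t * p (a - b) ∂μ := by
          refine norm_integral_le_of_norm_le (hint'.mul_const _) (ae_of_all _ fun t => ?_)
          rw [Real.norm_eq_abs, abs_mul, abs_of_nonneg (φ.nonneg_normed t)]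
          by_cases ht : t ∈ ball (0 : E) φ.rOut
          · refine mul_le_mul_of_nonneg_left ?_ (φ.nonneg_normed t)
            have hmem : ∀ c ∈ ball u₀ (δ / 2), c - t ∈ ball u₀ δ := fun c hc => by
              have h1 : ‖t‖ < δ / 2 := by
                rw [mem_ball_zero_iff] at ht
                exact lt_of_lt_of_le ht (min_le_right _ _)
              rw [mem_ball, dist_eq_norm] at hc ⊢
              calc ‖c - t - u₀‖ = ‖(c - u₀) - t‖ := by congr 1; abel
                _ ≤ ‖c - u₀‖ + ‖t‖ := norm_sub_le _ _
                _ < δ := by linarith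
            have := h _ (hmem a ha) _ (hmem b hb)
            simpa using this
          · have : φ.normed μ t = 0 := by
              have h0 : t ∉ Function.support (φ.normed μ) := by
                rwa [φ.support_normed_eq]
              simpa using h0
            simp [this]
      _ = p (a - b) := by rw [integral_mul_const, φ.integral_normed, one_mul]

end Mollify

/-! ### Calculus of directional derivatives. -/

section DirDeriv

variable {d : ℕ} {M : Type*} [TopologicalSpace M] [ChartedSpace (EuclideanSpace ℝ (Fin d)) M]

/-- The derivative of a real function in the direction of a tangent vector. -/
noncomputable def dirDeriv (f : M → ℝ) (x : M) (w : TangentSpace (𝓡 d) x) : ℝ :=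
  mfderiv (𝓡 d) 𝓘(ℝ, ℝ) f x w

theorem dirDeriv_smul_vec (f : M → ℝ) (x : M) (c : ℝ) (w : TangentSpace (𝓡 d) x) :
    dirDeriv f x (c • w) = c * dirDeriv f x w :=
  map_smul (mfderiv (𝓡 d) 𝓘(ℝ, ℝ) f x) c w

theorem dirDeriv_const (c : ℝ) (x : M) (w : TangentSpace (𝓡 d) x) :
    dirDeriv (fun _ : M => c) x w = 0 := by
  unfold dirDeriv
  rw [mfderiv_const]; rfl

theorem dirDeriv_congr {f g : M → ℝ} {x : M} (h : f =ᶠ[𝓝 x] g) (w : TangentSpace (𝓡 d) x) :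
    dirDeriv f x w = dirDeriv g x w := by
  unfold dirDeriv
  rw [h.mfderiv_eq]; rfl

theorem dirDeriv_add {f g : M → ℝ} {x : M} (hf : MDifferentiableAt (𝓡 d) 𝓘(ℝ, ℝ) f x)
    (hg : MDifferentiableAt (𝓡 d) 𝓘(ℝ, ℝ) g x) (w : TangentSpace (𝓡 d) x) :
    dirDeriv (fun y => f y + g y) x w = dirDeriv f x w + dirDeriv g x w :=
  congrArg (fun L : TangentSpace (𝓡 d) x →L[ℝ] ℝ => L w) (mfderiv_add hf hg)

theorem dirDeriv_sub {f g : M → ℝ} {x : M} (hf : MDifferentiableAt (𝓡 d) 𝓘(ℝ, ℝ) f x)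
    (hg : MDifferentiableAt (𝓡 d) 𝓘(ℝ, ℝ) g x) (w : TangentSpace (𝓡 d) x) :
    dirDeriv (fun y => f y - g y) x w = dirDeriv f x w - dirDeriv g x w :=
  congrArg (fun L : TangentSpace (𝓡 d) x →L[ℝ] ℝ => L w) (mfderiv_sub hf hg)

theorem dirDeriv_mul {f g : M → ℝ} {x : M} (hf : MDifferentiableAt (𝓡 d) 𝓘(ℝ, ℝ) f x)
    (hg : MDifferentiableAt (𝓡 d) 𝓘(ℝ, ℝ) g x) (w : TangentSpace (𝓡 d) x) :
    dirDeriv (fun y => f y * g y) x w = f x * dirDeriv g x w + g x * dirDeriv f x w :=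
  congrArg (fun L : TangentSpace (𝓡 d) x →L[ℝ] ℝ => L w)
    (hf.hasMFDerivAt.mul hg.hasMFDerivAt).mfderiv

theorem dirDeriv_comp {f : M → ℝ} {φ : ℝ → ℝ} {φ' : ℝ} {x : M}
    (hφ : HasDerivAt φ φ' (f x)) (hf : MDifferentiableAt (𝓡 d) 𝓘(ℝ, ℝ) f x)
    (w : TangentSpace (𝓡 d) x) :
    dirDeriv (fun y => φ (f y)) x w = φ' * dirDeriv f x w := by
  have h := (hφ.hasFDerivAt.hasMFDerivAt.comp x hf.hasMFDerivAt).mfderiv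
  have h2 := congrArg (fun L : TangentSpace (𝓡 d) x →L[ℝ] ℝ => L w) h
  refine h2.trans ?_
  change dirDeriv f x w * φ' = _
  rw [mul_comm]

theorem dirDeriv_sum {ι : Type*} (t : Finset ι) {f : ι → M → ℝ} {x : M}
    (hf : ∀ i ∈ t, MDifferentiableAt (𝓡 d) 𝓘(ℝ, ℝ) (f i) x) (w : TangentSpace (𝓡 d) x) :
    MDifferentiableAt (𝓡 d) 𝓘(ℝ, ℝ) (fun y => ∑ i ∈ t, f i y) x ∧
    dirDeriv (fun y => ∑ i ∈ t, f i y) x w = ∑ i ∈ t, dirDeriv (f i) x w := by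
  classical
  induction t using Finset.induction_on with
  | empty => simpa using! ⟨mdifferentiableAt_const, dirDeriv_const 0 x w⟩
  | insert i s hi IH =>
    obtain ⟨h1, h2⟩ := IH fun j hj => hf j (Finset.mem_insert_of_mem hj)
    have hi' := hf i (Finset.mem_insert_self _ _)
    simp only [Finset.sum_insert hi]
    exact ⟨hi'.add h1, by rw [dirDeriv_add hi' h1, h2]⟩

end DirDeriv

/-! ### Smoothing inside one chart. -/

section Chart

variable {d : ℕ} {M : Type*} [TopologicalSpace M] [ChartedSpace (EuclideanSpace ℝ (Fin d)) M]
  [IsManifold (𝓡 d) ∞ M]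

local notation "𝔼" d => EuclideanSpace ℝ (Fin d)

/-- The differential at `y` of the chart around `x`. -/
noncomputable def chartDeriv (x y : M) : TangentSpace (𝓡 d) y →L[ℝ] EuclideanSpace ℝ (Fin d) :=
  (trivializationAt (EuclideanSpace ℝ (Fin d)) (TangentSpace (𝓡 d)) x).continuousLinearMapAt ℝ y

theorem dirDeriv_comp_extChartAt {x y : M} (hy : y ∈ (chartAt (𝔼 d) x).source) {F : (𝔼 d) → ℝ}
    (hF : DifferentiableAt ℝ F (extChartAt (𝓡 d) x y)) (w : TangentSpace (𝓡 d) y) :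
    dirDeriv (fun z => F (extChartAt (𝓡 d) x z)) y w =
      fderiv ℝ F (extChartAt (𝓡 d) x y) (chartDeriv x y w) := by
  have h := (hF.hasFDerivAt.hasMFDerivAt.comp y (mdifferentiableAt_extChartAt hy).hasMFDerivAt).mfderiv
  have h2 := congrArg (fun L : TangentSpace (𝓡 d) y →L[ℝ] ℝ => L w) h
  refine h2.trans ?_
  unfold chartDeriv
  rw [TangentBundle.continuousLinearMapAt_trivializationAt hy]
  rfl

theorem exists_contMDiffOn_chart_approx {f : M → ℝ} (hf : Continuous f) (x : M)
    {ℓ : (𝔼 d) →L[ℝ] ℝ} {p : (𝔼 d) → ℝ} (hp : ∀ (t : ℝ) w, p (t • w) = |t| * p w)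
    {r : ℝ} (hr : 0 < r) (hrt : ball (extChartAt (𝓡 d) x x) r ⊆ (extChartAt (𝓡 d) x).target)
    (h : ∀ a ∈ ball (extChartAt (𝓡 d) x x) r, ∀ b ∈ ball (extChartAt (𝓡 d) x x) r,
      |f ((extChartAt (𝓡 d) x).symm a) - f ((extChartAt (𝓡 d) x).symm b) - ℓ (a - b)| ≤ p (a - b))
    {δ : ℝ} (hδ : 0 < δ) :
    ∃ g : M → ℝ, ContMDiffOn (𝓡 d) 𝓘(ℝ, ℝ) ∞ g (chartAt (𝔼 d) x).source ∧
      ∀ y ∈ (chartAt (𝔼 d) x).source,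
        extChartAt (𝓡 d) x y ∈ ball (extChartAt (𝓡 d) x x) (r / 4 / 2) →
        |g y - f y| ≤ δ ∧ ∀ w, |dirDeriv g y w - ℓ (chartDeriv x y w)| ≤ p (chartDeriv x y w) := by
  set φ := extChartAt (𝓡 d) x with hφ
  -- The bump extends `f ∘ φ⁻¹` by zero to the whole space without changing it on the ball of radius
  -- `r / 4`; mollifying then halves this radius.
  let b : ContDiffBump (φ x) := ⟨r / 4, r / 2, by positivity, by linarith⟩
  let G : (𝔼 d) → ℝ := fun u => b u * f (φ.symm u)
  have hFc : ContinuousOn (fun u => f (φ.symm u)) (ball (φ x) r) :=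
    hf.comp_continuousOn ((continuousOn_extChartAt_symm x).mono hrt)
  have hts : tsupport b ⊆ ball (φ x) r := by
    rw [b.tsupport_eq]; exact closedBall_subset_ball (by change r / 2 < r; linarith)
  have hG : Continuous G := by
    rw [continuous_iff_continuousAt]
    intro u
    by_cases hu : u ∈ tsupport b
    · exact b.continuous.continuousAt.mul (hFc.continuousAt (isOpen_ball.mem_nhds (hts hu)))
    · have : G =ᶠ[𝓝 u] fun _ => 0 := by
        filter_upwards [(isClosed_tsupport b).isOpen_compl.mem_nhds hu] with v hv
        simp [G, image_eq_zero_of_notMem_tsupport hv]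
      exact continuousAt_const.congr this.symm
  have hGf : ∀ u ∈ ball (φ x) (r / 4), G u = f (φ.symm u) := fun u hu => by
    simp only [G]
    rw [b.one_of_mem_closedBall (ball_subset_closedBall hu), one_mul]
  have hsub : ball (φ x) (r / 4) ⊆ ball (φ x) r := ball_subset_ball (by linarith)
  obtain ⟨F, hF, hFG, hF'⟩ := exists_contDiff_approx hG b.hasCompactSupport.mul_right (ℓ := ℓ) hp
    (u₀ := φ x) (δ := r / 4) (by positivity) (fun a ha c hc => by
      rw [hGf a ha, hGf c hc]; exact h a (hsub ha) c (hsub hc)) hδ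
  refine ⟨fun y => F (φ y), ?_, fun y hy hyb => ⟨?_, fun w => ?_⟩⟩
  · exact hF.contMDiff.comp_contMDiffOn contMDiffOn_extChartAt
  · have h1 := hFG (φ y)
    rwa [hGf _ (ball_subset_ball (by linarith) hyb), φ.left_inv (by simpa [hφ] using hy)] at h1
  · rw [dirDeriv_comp_extChartAt hy (hF.differentiable (by simp) _)]
    exact hF' _ hyb _

end Chart

/-! ### Smooth approximation with control of differentials. -/

section LocalApprox

variable {d : ℕ} {M : Type*} [TopologicalSpace M] [ChartedSpace (EuclideanSpace ℝ (Fin d)) M]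

local notation "𝔼" d => EuclideanSpace ℝ (Fin d)

theorem preimage_chart_ball_mem_nhds (x : M) {r : ℝ} (hr : 0 < r) :
    {y | y ∈ (chartAt (𝔼 d) x).source ∧ extChartAt (𝓡 d) x y ∈ ball (extChartAt (𝓡 d) x x) r}
      ∈ 𝓝 x :=
  inter_mem (chart_source_mem_nhds _ x)
    ((continuousAt_extChartAt x).preimage_mem_nhds (ball_mem_nhds _ hr))

variable [IsManifold (𝓡 d) ∞ M]

/-- A `C¹` function is strictly differentiable at the centre of the chart, so a single `ℓ` serves
all pairs of points nearby; the bound on differentials follows from the two-point bound. -/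
theorem exists_chart_ball_approx {f : M → ℝ} (hf : ContMDiff (𝓡 d) 𝓘(ℝ, ℝ) 1 f) (x : M)
    {ε : ℝ} (hε : 0 < ε) :
    ∃ (ℓ : (𝔼 d) →L[ℝ] ℝ) (r : ℝ), 0 < r ∧
      ball (extChartAt (𝓡 d) x x) r ⊆ (extChartAt (𝓡 d) x).target ∧
      (∀ a ∈ ball (extChartAt (𝓡 d) x x) r, ∀ b ∈ ball (extChartAt (𝓡 d) x x) r,
        |f ((extChartAt (𝓡 d) x).symm a) - f ((extChartAt (𝓡 d) x).symm b) - ℓ (a - b)|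
          ≤ ε * ‖a - b‖) ∧
      ∀ y ∈ (chartAt (𝔼 d) x).source, extChartAt (𝓡 d) x y ∈ ball (extChartAt (𝓡 d) x x) r →
        ∀ w, |dirDeriv f y w - ℓ (chartDeriv x y w)| ≤ ε * ‖chartDeriv x y w‖ := by
  obtain ⟨c, rfl⟩ : ∃ c : NNReal, (c : ℝ) = ε := ⟨⟨ε, hε.le⟩, rfl⟩
  set φ := extChartAt (𝓡 d) x with hφ
  have hFc : ContDiffOn ℝ 1 (fun u => f (φ.symm u)) φ.target := by
    rw [← contMDiffOn_iff_contDiffOn]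
    exact hf.comp_contMDiffOn (contMDiffOn_extChartAt_symm x)
  have hopen : IsOpen φ.target := isOpen_extChartAt_target x
  have hmem : φ x ∈ φ.target := mem_extChartAt_target x
  have hstrict := (hFc.contDiffAt (hopen.mem_nhds hmem)).hasStrictFDerivAt one_ne_zero
  obtain ⟨s, hs, hsa⟩ := hstrict.approximates_deriv_on_nhds (c := c)
    (Or.inr (NNReal.coe_pos.1 hε))
  obtain ⟨r, hr, hrs⟩ := Metric.mem_nhds_iff.1 (inter_mem hs (hopen.mem_nhds hmem))
  have hab : ∀ a ∈ ball (φ x) r, ∀ b ∈ ball (φ x) r,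
      |f (φ.symm a) - f (φ.symm b) - fderiv ℝ (fun u => f (φ.symm u)) (φ x) (a - b)|
        ≤ c * ‖a - b‖ := fun a ha b hb => hsa a (hrs ha).1 b (hrs hb).1
  refine ⟨_, r, hr, fun u hu => (hrs hu).2, hab, fun y hy hyr w => ?_⟩
  have hdiff : DifferentiableAt ℝ (fun u => f (φ.symm u)) (φ y) :=
    (hFc.contDiffAt (hopen.mem_nhds (hrs hyr).2)).differentiableAt one_ne_zero
  have hcongr : f =ᶠ[𝓝 y] fun z => f (φ.symm (φ z)) := by
    filter_upwards [(chartAt (𝔼 d) x).open_source.mem_nhds hy] with z hz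
    rw [φ.left_inv (by simpa [hφ] using hz)]
  rw [dirDeriv_congr hcongr, dirDeriv_comp_extChartAt (F := fun u => f (φ.symm u)) hy hdiff]
  exact abs_fderiv_sub_le_of_forall_abs_sub_le hdiff (p := fun w => c * ‖w‖)
    (fun t w => by rw [norm_smul, Real.norm_eq_abs]; ring) isOpen_ball hab hyr _

variable [RiemannianBundle (fun x : M => TangentSpace (𝓡 d) x)]

/-- Near `x`, the function `f` is a uniform limit of smooth functions whose differentials are
within `C` of `α`. -/
def HasLocalApprox (f : M → ℝ) (α : (y : M) → TangentSpace (𝓡 d) y → ℝ) (C : ℝ) (x : M) : Prop :=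
  ∃ U ∈ 𝓝 x, ∀ δ > 0, ∃ g : M → ℝ, ContMDiffOn (𝓡 d) 𝓘(ℝ, ℝ) ∞ g U ∧
    ∀ y ∈ U, |g y - f y| ≤ δ ∧ ∀ w, |dirDeriv g y w - α y w| ≤ C * ‖w‖

variable [IsContinuousRiemannianBundle (EuclideanSpace ℝ (Fin d))
  (fun x : M => TangentSpace (𝓡 d) x)]

theorem eventually_norm_chartDeriv_le (x : M) :
    ∃ C > 0, ∀ᶠ y in 𝓝 x, ∀ w, ‖chartDeriv (d := d) x y w‖ ≤ C * ‖w‖ := by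
  obtain ⟨C, hC, h⟩ := eventually_norm_trivializationAt_lt (𝔼 d)
    (fun x : M => TangentSpace (𝓡 d) x) x
  refine ⟨C, hC, ?_⟩
  filter_upwards [h] with y hy w
  exact (ContinuousLinearMap.le_opNorm _ _).trans (by gcongr; exact hy.le)

theorem hasLocalApprox_dirDeriv {f : M → ℝ} (hf : ContMDiff (𝓡 d) 𝓘(ℝ, ℝ) 1 f)
    {ε : ℝ} (hε : 0 < ε) (x : M) : HasLocalApprox f (fun y w => dirDeriv (d := d) f y w) ε x := by
  obtain ⟨C, hC, hCx⟩ := eventually_norm_chartDeriv_le (d := d) x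
  obtain ⟨ℓ, r, hr, hrt, hab, hder⟩ := exists_chart_ball_approx hf x
    -- The error occurs twice, from `dg` to `ℓ` and from `ℓ` to `df`, and `C` bounds the
    -- differential of the chart.
    (ε := ε / (2 * C)) (by positivity)
  refine ⟨_, inter_mem hCx (preimage_chart_ball_mem_nhds (d := d) x (r := r / 4 / 2) (by positivity)),
    fun δ hδ => ?_⟩
  obtain ⟨g, hg, hg'⟩ := exists_contMDiffOn_chart_approx hf.continuous x
    (p := fun w => ε / (2 * C) * ‖w‖)
    (fun t w => by rw [norm_smul, Real.norm_eq_abs]; ring) hr hrt hab hδ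
  refine ⟨g, hg.mono fun y hy => hy.2.1, fun y hy => ?_⟩
  obtain ⟨h1, h2⟩ := hg' y hy.2.1 hy.2.2
  refine ⟨h1, fun w => ?_⟩
  have h3 := hder y hy.2.1 (ball_subset_ball (by linarith) hy.2.2) w
  have h4 := h2 w
  have h5 : ‖chartDeriv x y w‖ ≤ C * ‖w‖ := hy.1 w
  rw [abs_sub_comm] at h3
  calc |dirDeriv g y w - dirDeriv f y w|
      ≤ |dirDeriv g y w - ℓ (chartDeriv x y w)| + |ℓ (chartDeriv x y w) - dirDeriv f y w| :=
        abs_sub_le _ _ _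
    _ ≤ 2 * (ε / (2 * C) * (C * ‖w‖)) := by
        have : ε / (2 * C) * ‖chartDeriv x y w‖ ≤ ε / (2 * C) * (C * ‖w‖) := by gcongr
        linarith
    _ = ε * ‖w‖ := by field_simp

theorem exists_abs_dirDeriv_le {f : M → ℝ} (hf : ContMDiff (𝓡 d) 𝓘(ℝ, ℝ) 1 f)
    {K : Set M} (hK : IsCompact K) :
    ∃ D, 0 ≤ D ∧ ∀ y ∈ K, ∀ w : TangentSpace (𝓡 d) y, |dirDeriv f y w| ≤ D * ‖w‖ := by
  refine hK.induction_on (p := fun s => ∃ D, 0 ≤ D ∧ ∀ y ∈ s, ∀ w : TangentSpace (𝓡 d) y,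
    |dirDeriv f y w| ≤ D * ‖w‖) ⟨0, le_rfl, by simp⟩ ?_ ?_ fun x _ => ?_
  · rintro s t hst ⟨D, hD, h⟩
    exact ⟨D, hD, fun y hy => h y (hst hy)⟩
  · rintro s t ⟨D, hD, h⟩ ⟨D', hD', h'⟩
    refine ⟨max D D', le_max_of_le_left hD, fun y hy w => ?_⟩
    rcases hy with hy | hy
    · exact (h y hy w).trans (mul_le_mul_of_nonneg_right (le_max_left _ _) (norm_nonneg _))
    · exact (h' y hy w).trans (mul_le_mul_of_nonneg_right (le_max_right _ _) (norm_nonneg _))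
  · obtain ⟨C, hC, hCx⟩ := eventually_norm_chartDeriv_le (d := d) x
    obtain ⟨ℓ, r, hr, -, -, hder⟩ := exists_chart_ball_approx hf x one_pos
    refine ⟨_, mem_nhdsWithin_of_mem_nhds (inter_mem hCx (preimage_chart_ball_mem_nhds (d := d) x hr)),
      (1 + ‖ℓ‖) * C, by positivity, fun y hy w => ?_⟩
    have h1 := hder y hy.2.1 hy.2.2 w
    have h2 : ‖chartDeriv x y w‖ ≤ C * ‖w‖ := hy.1 w
    have h3 : |ℓ (chartDeriv x y w)| ≤ ‖ℓ‖ * ‖chartDeriv x y w‖ := ℓ.le_opNorm _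
    calc |dirDeriv f y w|
        ≤ |dirDeriv f y w - ℓ (chartDeriv x y w)| + |ℓ (chartDeriv x y w)| := by
          simpa using abs_add_le (dirDeriv f y w - ℓ (chartDeriv x y w)) (ℓ (chartDeriv x y w))
      _ ≤ (1 + ‖ℓ‖) * ‖chartDeriv x y w‖ := by linarith
      _ ≤ (1 + ‖ℓ‖) * C * ‖w‖ := by
          rw [mul_assoc]; gcongr

/-- Gluing local smooth approximations of a compactly supported function. -/
theorem exists_contMDiff_approx [T2Space M] [SigmaCompactSpace M]
    {f : M → ℝ} {α : (y : M) → TangentSpace (𝓡 d) y → ℝ} {C : ℝ}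
    (h : ∀ x, HasLocalApprox (d := d) f α C x) {K K' : Set M} (hK : IsCompact K) (hK' : IsCompact K')
    (hKK' : K ⊆ interior K') (hfK : ∀ y ∉ K, f y = 0) (hαK : ∀ y ∉ K, ∀ w, α y w = 0)
    (hC : 0 ≤ C) {δ : ℝ} (hδ : 0 < δ) :
    ∃ F : M → ℝ, ContMDiff (𝓡 d) 𝓘(ℝ, ℝ) ∞ F ∧ (∀ y ∉ K', F y = 0) ∧
      ∀ y, |F y - f y| ≤ δ ∧ ∀ w, |dirDeriv F y w - α y w| ≤ (C + δ) * ‖w‖ := by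
  classical
  choose U hU hUg using h
  obtain ⟨t, -, htK⟩ := hK.elim_nhds_subcover (fun x => interior (U x))
    fun x _ => interior_mem_nhds.2 (hU x)
  -- The index `none` stands for the complement of `K`, where zero is an exact approximation; the
  -- other sets stay in `K'`, which forces the support and bounds the `dψ i`.
  let W : Option t → Set M := fun i => i.elim Kᶜ fun j => interior (U j) ∩ interior K'
  have hWo : ∀ i, IsOpen (W i) := fun i => by
    cases i with
    | none => exact hK.isClosed.isOpen_compl
    | some j => exact isOpen_interior.inter isOpen_interior
  have hWc : (univ : Set M) ⊆ ⋃ i, W i := fun y _ => by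
    by_cases hy : y ∈ K
    · obtain ⟨x, hx, hyx⟩ := mem_iUnion₂.1 (htK hy)
      exact mem_iUnion.2 ⟨some ⟨x, hx⟩, hyx, hKK' hy⟩
    · exact mem_iUnion.2 ⟨none, hy⟩
  obtain ⟨ψ, hψ⟩ := SmoothPartitionOfUnity.exists_isSubordinate (𝓡 d) isClosed_univ W hWo hWc
  have hψsm : ∀ i, ContMDiff (𝓡 d) 𝓘(ℝ, ℝ) ∞ (ψ i) := fun i => (ψ i).contMDiff
  choose D hD0 hD using fun i => exists_abs_dirDeriv_le ((hψsm i).of_le (by simp)) hK'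
  set S : ℝ := ∑ i, D i with hS
  have hS0 : 0 ≤ S := Finset.sum_nonneg fun i _ => hD0 i
  -- The neighbourhoods `U x` do not depend on the accuracy, so the partition and its derivative
  -- bounds `D i` are fixed before `δ'` is chosen to absorb their sum.
  set δ' : ℝ := δ / (S + 1) with hδ'
  have hδ'0 : 0 < δ' := by positivity
  have hδ'S : δ' * S ≤ δ := by
    rw [hδ', div_mul_eq_mul_div, div_le_iff₀ (by positivity)]
    nlinarith
  have hδ'δ : δ' ≤ δ := div_le_self hδ.le (by linarith)
  choose g₀ hg₀ hg₀' using fun x => hUg x δ' hδ'0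
  let g : Option t → M → ℝ := fun i => i.elim (fun _ => 0) fun j => g₀ j
  have hg : ∀ i, ContMDiffOn (𝓡 d) 𝓘(ℝ, ℝ) ∞ (g i) (W i) := fun i => by
    cases i with
    | none => exact contMDiffOn_const
    | some j => exact (hg₀ j).mono fun y hy => interior_subset hy.1
  have hgf : ∀ i, ∀ y ∈ W i, |g i y - f y| ≤ δ' ∧ ∀ w, |dirDeriv (g i) y w - α y w| ≤ C * ‖w‖ :=
    fun i y hy => by
      cases i with
      | none =>
        refine ⟨by simp [g, hfK y hy, hδ'0.le], fun w => ?_⟩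
        simp only [g, Option.elim, dirDeriv_const, hαK y hy, sub_zero, abs_zero]
        positivity
      | some j => exact hg₀' j y (interior_subset hy.1)
  have hgD : ∀ i, ∀ y ∈ W i, ∀ w : TangentSpace (𝓡 d) y, |(g i y - f y) * dirDeriv (ψ i) y w| ≤ δ' * D i * ‖w‖ :=
    fun i y hy w => by
      cases i with
      | none =>
        simp only [g, Option.elim, hfK y hy, sub_zero, zero_mul, abs_zero]
        exact mul_nonneg (mul_nonneg hδ'0.le (hD0 none)) (norm_nonneg w)
      | some j =>
        rw [abs_mul, mul_assoc]
        exact mul_le_mul (hgf _ y hy).1 (hD _ y (interior_subset hy.2) w) (abs_nonneg _) hδ'0.le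
  have hsm : ∀ i, ContMDiff (𝓡 d) 𝓘(ℝ, ℝ) ∞ fun y => ψ i y * g i y := fun i =>
    ψ.contMDiff_smul fun y hy => (hg i).contMDiffAt ((hWo i).mem_nhds (hψ i hy))
  have hsum : ∀ y, ∑ i, ψ i y = 1 := fun y => by
    rw [← finsum_eq_sum_of_fintype]; exact ψ.sum_eq_one (mem_univ y)
  have hsumd : ∀ (y : M) (w : TangentSpace (𝓡 d) y), ∑ i, dirDeriv (ψ i) y w = 0 := fun y w => by
    rw [← (dirDeriv_sum Finset.univ (fun i _ => (hψsm i).mdifferentiable (by simp) y) w).2]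
    simp_rw [hsum]
    exact dirDeriv_const 1 y w
  refine ⟨fun y => ∑ i, ψ i y * g i y, contMDiff_finsetSum fun i _ => hsm i, fun y hy => ?_,
    fun y => ⟨?_, fun w => ?_⟩⟩
  · refine Finset.sum_eq_zero fun i _ => ?_
    cases i with
    | none => simp [g]
    | some j =>
      have : y ∉ tsupport (ψ (some j)) := fun hy' => hy (interior_subset (hψ _ hy').2)
      rw [image_eq_zero_of_notMem_tsupport this, zero_mul]
  · have e : ∑ i, ψ i y * g i y - f y = ∑ i, ψ i y * (g i y - f y) := by
      simp_rw [mul_sub]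
      rw [Finset.sum_sub_distrib, ← Finset.sum_mul, hsum, one_mul]
    rw [e]
    calc |∑ i, ψ i y * (g i y - f y)| ≤ ∑ i, ψ i y * δ' := by
          refine (Finset.abs_sum_le_sum_abs _ _).trans (Finset.sum_le_sum fun i _ => ?_)
          rw [abs_mul, abs_of_nonneg (ψ.nonneg i y)]
          by_cases hy : y ∈ tsupport (ψ i)
          · exact mul_le_mul_of_nonneg_left (hgf i y (hψ i hy)).1 (ψ.nonneg i y)
          · rw [image_eq_zero_of_notMem_tsupport hy]; simp
      _ = δ' := by rw [← Finset.sum_mul, hsum, one_mul]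
      _ ≤ δ := hδ'δ
  · rw [(dirDeriv_sum Finset.univ (fun i _ => (hsm i).mdifferentiable (by simp) y) w).2]
    -- Since `∑ ψ i = 1` and `∑ dψ i = 0`, the total error is `∑ ψ i (dg i - α) + ∑ (g i - f) dψ i`;
    -- subtracting `f dψ i` makes the second sum small.
    have key : ∀ i, |dirDeriv (fun y => ψ i y * g i y) y w - ψ i y * α y w
        - f y * dirDeriv (ψ i) y w| ≤ ψ i y * (C * ‖w‖) + δ' * D i * ‖w‖ := fun i => by
      by_cases hy : y ∈ tsupport (ψ i)
      · have hyW := hψ i hy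
        have hgd : MDifferentiableAt (𝓡 d) 𝓘(ℝ, ℝ) (g i) y :=
          ((hg i).contMDiffAt ((hWo i).mem_nhds hyW)).mdifferentiableAt (by simp)
        rw [dirDeriv_mul ((hψsm i).mdifferentiable (by simp) y) hgd]
        have e : ψ i y * dirDeriv (g i) y w + g i y * dirDeriv (ψ i) y w - ψ i y * α y w
            - f y * dirDeriv (ψ i) y w = ψ i y * (dirDeriv (g i) y w - α y w)
            + (g i y - f y) * dirDeriv (ψ i) y w := by ring
        rw [e]
        refine (abs_add_le _ _).trans (add_le_add ?_ (hgD i y hyW w))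
        rw [abs_mul, abs_of_nonneg (ψ.nonneg i y)]
        exact mul_le_mul_of_nonneg_left ((hgf i y hyW).2 w) (ψ.nonneg i y)
      · have h0 : ∀ᶠ z in 𝓝 y, ψ i z = 0 := by
          filter_upwards [(isClosed_tsupport (ψ i)).isOpen_compl.mem_nhds hy] with z hz
          exact image_eq_zero_of_notMem_tsupport hz
        have h1 : dirDeriv (ψ i) y w = 0 :=
          (dirDeriv_congr (g := fun _ => 0) h0 w).trans (dirDeriv_const 0 y w)
        have h2 : dirDeriv (fun y => ψ i y * g i y) y w = 0 :=
          (dirDeriv_congr (g := fun _ => 0) (h0.mono fun z hz => by simp [hz]) w).trans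
            (dirDeriv_const 0 y w)
        rw [h1, h2, h0.self_of_nhds]
        simp only [zero_mul, mul_zero, sub_zero, abs_zero, zero_add]
        exact mul_nonneg (mul_nonneg hδ'0.le (hD0 i)) (norm_nonneg w)
    have e : ∑ i, dirDeriv (fun y => ψ i y * g i y) y w - α y w =
        ∑ i, (dirDeriv (fun y => ψ i y * g i y) y w - ψ i y * α y w
          - f y * dirDeriv (ψ i) y w) := by
      rw [Finset.sum_sub_distrib, Finset.sum_sub_distrib, ← Finset.sum_mul, hsum, ← Finset.mul_sum,
        hsumd]
      ring
    rw [e]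
    calc _ ≤ ∑ i, (ψ i y * (C * ‖w‖) + δ' * D i * ‖w‖) :=
          (Finset.abs_sum_le_sum_abs _ _).trans (Finset.sum_le_sum fun i _ => key i)
      _ = (C + δ' * S) * ‖w‖ := by
          rw [Finset.sum_add_distrib, ← Finset.sum_mul, hsum, ← Finset.sum_mul, ← Finset.mul_sum]
          ring
      _ ≤ (C + δ) * ‖w‖ := by gcongr

end LocalApprox

/-! ### Smoothing Lipschitz functions, and cutoffs. -/

section Lipschitz

variable {d : ℕ} {M : Type*} [MetricSpace M]
  [ChartedSpace (EuclideanSpace ℝ (Fin d)) M] [IsManifold (𝓡 d) ∞ M]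
  [RiemannianBundle (fun x : M => TangentSpace (𝓡 d) x)]
  [IsContinuousRiemannianBundle (EuclideanSpace ℝ (Fin d)) (fun x : M => TangentSpace (𝓡 d) x)]

local notation "𝔼" d => EuclideanSpace ℝ (Fin d)

/-- The differential at the image of `y` of the inverse of the chart around `x`. -/
noncomputable def chartSymmDeriv (x y : M) : EuclideanSpace ℝ (Fin d) →L[ℝ] TangentSpace (𝓡 d) y :=
  (trivializationAt (EuclideanSpace ℝ (Fin d)) (TangentSpace (𝓡 d)) x).symmL ℝ y

omit [RiemannianBundle (fun x : M => TangentSpace (𝓡 d) x)]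
  [IsContinuousRiemannianBundle (EuclideanSpace ℝ (Fin d)) (fun x : M => TangentSpace (𝓡 d) x)] in
theorem chartDeriv_chartSymmDeriv_self (x : M) (a : 𝔼 d) :
    chartDeriv x x (chartSymmDeriv x x a) = a :=
  Trivialization.continuousLinearMapAt_symmL _ (FiberBundle.mem_baseSet_trivializationAt' x) a

/-- Continuity of the metric: any factor above `1` would do near the centre. -/
theorem eventually_norm_chartSymmDeriv_le (x : M) :
    ∀ᶠ y in 𝓝 x, ∀ a : 𝔼 d, ‖chartSymmDeriv x y a‖ ≤ 2 * ‖chartSymmDeriv x x a‖ := by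
  filter_upwards [eventually_norm_symmL_trivializationAt_comp_self_lt (𝔼 d)
    (fun x : M => TangentSpace (𝓡 d) x) x one_lt_two] with y hy a
  have h := (ContinuousLinearMap.le_opNorm _ (chartSymmDeriv x x a)).trans
    (mul_le_mul_of_nonneg_right hy.le (norm_nonneg _))
  have e : chartSymmDeriv x y a = chartSymmDeriv x y (chartDeriv x x (chartSymmDeriv x x a)) := by
    rw [chartDeriv_chartSymmDeriv_self]
  rw [e]
  exact h

theorem eventually_norm_chartSymmDeriv_chartDeriv_le (x : M) :
    ∀ᶠ y in 𝓝 x, ∀ w : TangentSpace (𝓡 d) y,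
      ‖chartSymmDeriv x x (chartDeriv x y w)‖ ≤ 2 * ‖w‖ := by
  filter_upwards [eventually_norm_symmL_trivializationAt_self_comp_lt (𝔼 d)
    (fun x : M => TangentSpace (𝓡 d) x) x one_lt_two] with y hy w
  exact (ContinuousLinearMap.le_opNorm _ w).trans
    (mul_le_mul_of_nonneg_right hy.le (norm_nonneg _))

omit [IsContinuousRiemannianBundle (EuclideanSpace ℝ (Fin d))
  (fun x : M => TangentSpace (𝓡 d) x)] in
theorem enorm_mfderivWithin_extChartAt_symm (x : M) {u : 𝔼 d}
    (hu : u ∈ (extChartAt (𝓡 d) x).target) (a : 𝔼 d) :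
    ‖mfderivWithin 𝓘(ℝ, 𝔼 d) (𝓡 d) (extChartAt (𝓡 d) x).symm (range (𝓡 d)) u a‖ₑ =
      ‖chartSymmDeriv x ((extChartAt (𝓡 d) x).symm u) a‖ₑ := by
  obtain ⟨y, hy, rfl⟩ : ∃ y ∈ (extChartAt (𝓡 d) x).source, extChartAt (𝓡 d) x y = u :=
    ⟨_, (extChartAt (𝓡 d) x).map_target hu, (extChartAt (𝓡 d) x).right_inv hu⟩
  have hyx : y ∈ (chartAt (𝔼 d) x).source := by simpa using hy
  -- The point `φ.symm (φ y)` equals `y` only propositionally; generalizing it allows the change of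
  -- tangent space.
  have key : ∀ y', y' = y → ‖(show TangentSpace (𝓡 d) y' from
      mfderivWithin 𝓘(ℝ, 𝔼 d) (𝓡 d) (extChartAt (𝓡 d) x).symm (range (𝓡 d))
        (extChartAt (𝓡 d) x y) a)‖ₑ = ‖chartSymmDeriv x y' a‖ₑ := by
    rintro y' rfl
    unfold chartSymmDeriv
    rw [TangentBundle.symmL_trivializationAt hyx]
    rfl
  exact key _ ((extChartAt (𝓡 d) x).left_inv hy)

/-- Near its centre, the inverse of a chart is `2`-Lipschitz for the Euclidean structure of the
tangent space at the centre. -/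
theorem exists_dist_extChartAt_symm_le [IsRiemannianManifold (𝓡 d) M] (x : M) :
    ∃ r > 0, ball (extChartAt (𝓡 d) x x) r ⊆ (extChartAt (𝓡 d) x).target ∧
      ∀ a ∈ ball (extChartAt (𝓡 d) x x) r, ∀ b ∈ ball (extChartAt (𝓡 d) x x) r,
        dist ((extChartAt (𝓡 d) x).symm a) ((extChartAt (𝓡 d) x).symm b) ≤
          2 * ‖chartSymmDeriv x x (a - b)‖ := by
  set φ := extChartAt (𝓡 d) x with hφ
  have hev : ∀ᶠ u in 𝓝 (φ x), ∀ a : 𝔼 d,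
      ‖chartSymmDeriv x (φ.symm u) a‖ ≤ 2 * ‖chartSymmDeriv x x a‖ := by
    have hc : Tendsto φ.symm (𝓝 (φ x)) (𝓝 x) := by
      have := (continuousAt_extChartAt_symm (I := 𝓡 d) x).tendsto
      rwa [extChartAt_to_inv] at this
    exact hc.eventually (eventually_norm_chartSymmDeriv_le x)
  obtain ⟨r, hr, hrs⟩ := Metric.mem_nhds_iff.1 (inter_mem hev (extChartAt_target_mem_nhds x))
  refine ⟨r, hr, fun u hu => (hrs hu).2, fun b hb a ha => ?_⟩
  rw [dist_comm]
  -- The distance is at most the length of the image of a Euclidean segment, whose speed is compared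
  -- with the metric at the centre.
  let η := ContinuousAffineMap.lineMap (R := ℝ) a b
  set γ := φ.symm ∘ η
  have hη : ∀ t ∈ Icc (0 : ℝ) 1, η t ∈ ball (φ x) r := fun t ht => by
    refine (convex_ball (φ x) r).segment_subset ha hb ?_
    rw [segment_eq_image_lineMap]
    exact ⟨t, ht, by simp [η, ContinuousAffineMap.coe_lineMap_eq]⟩
  have hηt : Icc (0 : ℝ) 1 ⊆ η ⁻¹' φ.target := fun t ht => (hrs (hη t ht)).2
  have η_smooth : ContMDiffOn 𝓘(ℝ, ℝ) 𝓘(ℝ, 𝔼 d) 1 η (Icc 0 1) := by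
    apply ContMDiff.contMDiffOn
    rw [contMDiff_iff_contDiff]
    exact ContinuousAffineMap.contDiff _
  have h1 : Manifold.riemannianEDist (𝓡 d) (φ.symm a) (φ.symm b) ≤
      Manifold.pathELength (𝓡 d) γ 0 1 := by
    apply Manifold.riemannianEDist_le_pathELength _ _ _ zero_le_one
    · exact (contMDiffOn_extChartAt_symm x).comp η_smooth hηt
    · simp [γ, η, ContinuousAffineMap.coe_lineMap_eq]
    · simp [γ, η, ContinuousAffineMap.coe_lineMap_eq]
  have h2 : Manifold.pathELength (𝓡 d) γ 0 1 ≤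
      ∫⁻ _ in Icc (0 : ℝ) 1, ENNReal.ofReal (2 * ‖chartSymmDeriv x x (b - a)‖) := by
    rw [Manifold.pathELength_eq_lintegral_mfderivWithin_Icc]
    refine setLIntegral_mono' measurableSet_Icc fun t ht => ?_
    have e1 : mfderivWithin 𝓘(ℝ, ℝ) (𝓡 d) γ (Icc 0 1) t =
        (mfderivWithin 𝓘(ℝ, 𝔼 d) (𝓡 d) φ.symm (range (𝓡 d)) (η t)) ∘L
          (mfderivWithin 𝓘(ℝ, ℝ) 𝓘(ℝ, 𝔼 d) η (Icc 0 1) t) := by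
      apply mfderivWithin_comp
      · exact mdifferentiableWithinAt_extChartAt_symm (hηt ht)
      · exact η_smooth.mdifferentiableOn one_ne_zero t ht
      · exact hηt.trans (preimage_mono (extChartAt_target_subset_range x))
      · rw [uniqueMDiffWithinAt_iff_uniqueDiffWithinAt]
        exact uniqueDiffOn_Icc zero_lt_one t ht
    have e2 : mfderivWithin 𝓘(ℝ, ℝ) (𝓡 d) γ (Icc 0 1) t 1 =
        (mfderivWithin 𝓘(ℝ, 𝔼 d) (𝓡 d) φ.symm (range (𝓡 d)) (η t))
          (mfderivWithin 𝓘(ℝ, ℝ) 𝓘(ℝ, 𝔼 d) η (Icc 0 1) t 1) := DFunLike.congr_fun e1 1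
    have e3 : (mfderivWithin 𝓘(ℝ, ℝ) 𝓘(ℝ, 𝔼 d) η (Icc 0 1) t 1 : 𝔼 d) = b - a := by
      rw [mfderivWithin_eq_fderivWithin]
      change fderivWithin ℝ η (Icc 0 1) t 1 = b - a
      rw [fderivWithin_eq_fderiv (uniqueDiffOn_Icc zero_lt_one _ ht)
        (ContinuousAffineMap.differentiableAt _)]
      simp [η]
    rw [e2]
    have e4 := enorm_mfderivWithin_extChartAt_symm x (hηt ht) (b - a)
    refine (le_of_eq ?_).trans ((e4.le).trans ?_)
    · rw [← e3]
    · rw [← ofReal_norm]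
      exact ENNReal.ofReal_le_ofReal ((hrs (hη t ht)).1 _)
  rw [← IsRiemannianManifold.out (I := 𝓡 d), edist_dist] at h1
  have h3 := h1.trans h2
  rw [setLIntegral_const, Real.volume_Icc, sub_zero, ENNReal.ofReal_one, mul_one,
    ENNReal.ofReal_le_ofReal_iff (by positivity)] at h3
  exact h3

/-- One factor `2` comes from the inverse chart, the other from comparing norms at `y` and at the
centre. The constant is free of the chart, so slowly varying functions get uniformly small
differentials. -/
theorem hasLocalApprox_zero_of_lipschitz [IsRiemannianManifold (𝓡 d) M] {f : M → ℝ} {L : ℝ}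
    (hL : 0 ≤ L) (hf : Continuous f) (hfL : ∀ y z, |f y - f z| ≤ L * dist y z) (x : M) :
    HasLocalApprox (d := d) f (fun _ _ => 0) (4 * L) x := by
  obtain ⟨r, hr, hrt, hab⟩ := exists_dist_extChartAt_symm_le (d := d) x
  refine ⟨_, inter_mem (eventually_norm_chartSymmDeriv_chartDeriv_le (d := d) x)
    (preimage_chart_ball_mem_nhds (d := d) x (r := r / 4 / 2) (by positivity)), fun δ hδ => ?_⟩
  obtain ⟨g, hg, hg'⟩ := exists_contMDiffOn_chart_approx (d := d) hf x (ℓ := 0)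
    (p := fun a => L * (2 * ‖chartSymmDeriv x x a‖))
    (fun t w => by rw [map_smul, norm_smul, Real.norm_eq_abs]; ring) hr hrt
    (fun a ha b hb => by
      rw [zero_apply, sub_zero]
      exact (hfL _ _).trans (mul_le_mul_of_nonneg_left (hab a ha b hb) hL)) hδ
  refine ⟨g, hg.mono fun y hy => hy.2.1, fun y hy => ?_⟩
  obtain ⟨h1, h2⟩ := hg' y hy.2.1 hy.2.2
  refine ⟨h1, fun w => ?_⟩
  have h3 : ‖chartSymmDeriv x x (chartDeriv x y w)‖ ≤ 2 * ‖w‖ := hy.1 w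
  calc |dirDeriv g y w - 0| ≤ L * (2 * ‖chartSymmDeriv x x (chartDeriv x y w)‖) := h2 w
    _ ≤ L * (2 * (2 * ‖w‖)) := by gcongr
    _ = 4 * L * ‖w‖ := by ring

/-- Smooth cutoff functions with small differentials on a complete Riemannian manifold. -/
theorem exists_smooth_cutoffs [IsRiemannianManifold (𝓡 d) M] [CompleteSpace M]
    [SigmaCompactSpace M] [Nonempty M] :
    ∃ χ : ℕ → M → ℝ, (∀ k, ContMDiff (𝓡 d) 𝓘(ℝ, ℝ) ∞ (χ k)) ∧
      (∀ k, HasCompactSupport (χ k)) ∧ (∀ k y, |χ k y| ≤ 2) ∧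
      (∀ y, Tendsto (fun k => χ k y) atTop (𝓝 1)) ∧
      ∀ k y, ∀ w : TangentSpace (𝓡 d) y, |dirDeriv (χ k) y w| ≤ 5 / (k + 1) * ‖w‖ := by
  obtain ⟨x₀⟩ := ‹Nonempty M›
  have : LocallyCompactSpace M := ChartedSpace.locallyCompactSpace (𝔼 d) M
  have : ProperSpace M := (hasApproxGeodesics_of_isRiemannianManifold d M).properSpace
  -- Equal to `1` up to radius `k + 1`, zero beyond `2 (k + 1)`, and `1 / (k + 1)`-Lipschitz.
  let f : ℕ → M → ℝ := fun k y => max 0 (min 1 (2 - dist x₀ y / (k + 1)))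
  have hf0 : ∀ k y, 0 ≤ f k y := fun k y => le_max_left _ _
  have hf1 : ∀ k y, f k y ≤ 1 := fun k y => max_le zero_le_one (min_le_left _ _)
  have hfc : ∀ k, Continuous (f k) := fun k => by fun_prop
  have hfL : ∀ k y z, |f k y - f k z| ≤ 1 / (k + 1) * dist y z := fun k y z => by
    have h1 : |f k y - f k z| ≤
        |(2 - dist x₀ y / (k + 1)) - (2 - dist x₀ z / ((k : ℝ) + 1))| := by
      refine (abs_max_sub_max_le_max _ _ _ _).trans ?_
      rw [sub_self, abs_zero]
      refine max_le (abs_nonneg _) ((abs_min_sub_min_le_max _ _ _ _).trans ?_)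
      rw [sub_self, abs_zero]
      exact max_le (abs_nonneg _) le_rfl
    refine h1.trans ?_
    rw [sub_sub_sub_cancel_left, ← sub_div, abs_div, abs_of_pos (by positivity : (0 : ℝ) < k + 1),
      one_div_mul_eq_div]
    gcongr
    rw [dist_comm x₀ z, dist_comm x₀ y, dist_comm y z]
    exact abs_dist_sub_le z y x₀
  -- Smoothing with tolerance `1 / (k + 1)` turns the slope `4 / (k + 1)` into `5 / (k + 1)` and the
  -- bound `1` into at most `2`.
  have key : ∀ k : ℕ, ∃ F : M → ℝ, ContMDiff (𝓡 d) 𝓘(ℝ, ℝ) ∞ F ∧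
      (∀ y ∉ closedBall x₀ (2 * (k + 1) + 1), F y = 0) ∧ ∀ y, |F y - f k y| ≤ 1 / (k + 1) ∧
        ∀ w : TangentSpace (𝓡 d) y, |dirDeriv F y w - 0| ≤ (4 * (1 / (k + 1)) + 1 / (k + 1)) * ‖w‖ :=
    fun k => exists_contMDiff_approx (α := fun _ _ => 0)
      (hasLocalApprox_zero_of_lipschitz (by positivity) (hfc k) (hfL k))
      (isCompact_closedBall x₀ (2 * (k + 1))) (isCompact_closedBall x₀ (2 * (k + 1) + 1))
      ((closedBall_subset_ball (by linarith)).trans ball_subset_interior_closedBall)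
      (fun y hy => by
        rw [mem_closedBall, not_le, dist_comm] at hy
        refine max_eq_left ((min_le_right _ _).trans ?_)
        rw [sub_nonpos, le_div_iff₀ (by positivity)]
        exact hy.le) (fun _ _ _ => rfl) (by positivity) (by positivity)
  choose χ hχs hχ0 hχ using key
  refine ⟨χ, hχs, fun k => ?_, fun k y => ?_, fun y => ?_, fun k y w => ?_⟩
  · exact HasCompactSupport.intro (isCompact_closedBall _ _) (hχ0 k)
  · have h1 := abs_le.1 (hχ k y).1
    have h2 : (1 : ℝ) / (k + 1) ≤ 1 := by
      rw [div_le_one (by positivity)]; linarith [Nat.cast_nonneg (α := ℝ) k]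
    exact abs_le.2 ⟨by linarith [hf0 k y], by linarith [hf1 k y]⟩
  · have h1 : Tendsto (fun k => χ k y - f k y) atTop (𝓝 0) :=
      squeeze_zero_norm (fun k => (hχ k y).1) tendsto_one_div_add_atTop_nhds_zero_nat
    have h2 : ∀ᶠ k : ℕ in atTop, f k y = 1 := by
      filter_upwards [eventually_ge_atTop ⌈dist x₀ y⌉₊] with k hk
      have h3 : dist x₀ y ≤ k := (Nat.le_ceil _).trans (by exact_mod_cast hk)
      have h4 : dist x₀ y / (k + 1) ≤ 1 := by
        rw [div_le_one (by positivity)]; linarith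
      simp only [f]
      rw [min_eq_left (by linarith), max_eq_right zero_le_one]
    have h3 : Tendsto (fun k => (χ k y - f k y) + f k y) atTop (𝓝 (0 + 1)) :=
      h1.add (tendsto_const_nhds.congr' (h2.mono fun k hk => hk.symm))
    simpa using h3
  · have h1 := (hχ k y).2 w
    rw [sub_zero] at h1
    refine h1.trans (le_of_eq ?_)
    ring

end Lipschitz

/-! ### Stokes formula for `C¹` test functions. -/

section TestFunctions

variable {d : ℕ} {M : Type*} [MetricSpace M]
  [ChartedSpace (EuclideanSpace ℝ (Fin d)) M] [IsManifold (𝓡 d) ∞ M]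

theorem continuous_dirDeriv {f : M → ℝ} (hf : ContMDiff (𝓡 d) 𝓘(ℝ, ℝ) 1 f)
    {Y : (x : M) → TangentSpace (𝓡 d) x}
    (hY : Continuous fun x : M => (⟨x, Y x⟩ : TotalSpace (EuclideanSpace ℝ (Fin d))
      (fun x : M => TangentSpace (𝓡 d) x))) :
    Continuous fun x => dirDeriv f x (Y x) := by
  have h1 : Continuous fun x : M => tangentMap (𝓡 d) 𝓘(ℝ, ℝ) f ⟨x, Y x⟩ :=
    (hf.continuous_tangentMap le_rfl).comp hY
  have h2 := (tangentBundleModelSpaceHomeomorph 𝓘(ℝ, ℝ)).continuous.comp h1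
  exact continuous_snd.comp h2

variable [RiemannianBundle (fun x : M => TangentSpace (𝓡 d) x)]
  [IsContinuousRiemannianBundle (EuclideanSpace ℝ (Fin d)) (fun x : M => TangentSpace (𝓡 d) x)]

theorem continuous_norm_section {Y : (x : M) → TangentSpace (𝓡 d) x}
    (hY : Continuous fun x : M => (⟨x, Y x⟩ : TotalSpace (EuclideanSpace ℝ (Fin d))
      (fun x : M => TangentSpace (𝓡 d) x))) :
    Continuous fun x => ‖Y x‖ := by
  have h : Continuous fun x => √(inner ℝ (Y x) (Y x)) := (hY.inner_bundle hY).sqrt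
  simpa only [← norm_eq_sqrt_real_inner] using h

variable [SigmaCompactSpace M] [MeasurableSpace M] [BorelSpace M]

/-- The Stokes formula defining the divergence extends to `C¹` test functions. -/
theorem HasDivergence.integral_eq [IsFiniteMeasureOnCompacts (riemVolume d M)]
    {Y : (x : M) → TangentSpace (𝓡 d) x} {D : M → ℝ} (h : HasDivergence Y D)
    (hYD : ∀ f : M → ℝ, ContMDiff (𝓡 d) 𝓘(ℝ, ℝ) 1 f → Continuous fun x => dirDeriv f x (Y x))
    (hYn : Continuous fun x => ‖Y x‖) (hD : Continuous D)
    {f : M → ℝ} (hf : ContMDiff (𝓡 d) 𝓘(ℝ, ℝ) 1 f) (hfc : HasCompactSupport f) :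
    ∫ x, D x * f x ∂(riemVolume d M) = - ∫ x, dirDeriv f x (Y x) ∂(riemVolume d M) := by
  set μ := riemVolume d M
  have : LocallyCompactSpace M := ChartedSpace.locallyCompactSpace (EuclideanSpace ℝ (Fin d)) M
  have hK : IsCompact (tsupport f) := hfc
  obtain ⟨K', hK', hKK'⟩ := exists_compact_superset hK
  have hfK' : ∀ y ∉ K', f y = 0 := fun y hy =>
    image_eq_zero_of_notMem_tsupport fun hy' => hy (interior_subset (hKK' hy'))
  have hd0 : ∀ {g : M → ℝ} {y}, y ∉ tsupport g → ∀ w : TangentSpace (𝓡 d) y,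
      dirDeriv g y w = 0 := fun {g y} hy w => by
    refine (dirDeriv_congr (g := fun _ => 0) ?_ w).trans (dirDeriv_const 0 y w)
    filter_upwards [(isClosed_tsupport g).isOpen_compl.mem_nhds hy] with z hz
    exact image_eq_zero_of_notMem_tsupport hz
  have hcont : ∀ {g : M → ℝ}, ContMDiff (𝓡 d) 𝓘(ℝ, ℝ) 1 g → (∀ y ∉ K', g y = 0) →
      Integrable (fun x => D x * g x) μ ∧ Integrable (fun x => dirDeriv g x (Y x)) μ ∧
      ∀ y ∉ K', dirDeriv g y (Y y) = 0 := fun {g} hg hg0 => by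
    have hts : tsupport g ⊆ K' := closure_minimal (fun y hy => by
      by_contra hy'; exact hy (hg0 y hy')) hK'.isClosed
    have h3 : ∀ y ∉ K', dirDeriv g y (Y y) = 0 := fun y hy => hd0 (fun hy' => hy (hts hy')) _
    refine ⟨?_, ?_, h3⟩
    · exact (hD.mul hg.continuous).integrable_of_hasCompactSupport
        (HasCompactSupport.intro hK' fun y hy => by simp [hg0 y hy])
    · exact (hYD g hg).integrable_of_hasCompactSupport (HasCompactSupport.intro hK' h3)
  obtain ⟨hf1, hf2, hf3⟩ := hcont hf hfK'
  set A := ∫ x in K', |D x| ∂μ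
  set B := ∫ x in K', ‖Y x‖ ∂μ
  have hA : IntegrableOn (fun x => |D x|) K' μ := hD.abs.continuousOn.integrableOn_compact hK'
  have hB : IntegrableOn (fun x => ‖Y x‖) K' μ := hYn.continuousOn.integrableOn_compact hK'
  have hA0 : 0 ≤ A := integral_nonneg fun _ => abs_nonneg _
  have hB0 : 0 ≤ B := integral_nonneg fun _ => norm_nonneg _
  -- All approximations vanish off the fixed compact `K'`, so `A` and `B` do not depend on `ε`; the
  -- `2` reflects the error `ε + ε` in the differential.
  have key : ∀ ε > 0, |∫ x, D x * f x ∂μ + ∫ x, dirDeriv f x (Y x) ∂μ| ≤ ε * (A + 2 * B) := by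
    intro ε hε
    obtain ⟨F, hF, hF0, hFf⟩ := exists_contMDiff_approx (α := fun y w => dirDeriv f y w)
      (hasLocalApprox_dirDeriv hf hε) hK hK' hKK' (fun y hy => image_eq_zero_of_notMem_tsupport hy)
      (fun y hy w => hd0 hy w) hε.le hε
    obtain ⟨hF1, hF2, hF3⟩ := hcont (hF.of_le (by simp)) hF0
    have e : ∫ x, D x * F x ∂μ = - ∫ x, dirDeriv F x (Y x) ∂μ :=
      h F hF (HasCompactSupport.intro hK' hF0)
    have e1 : |∫ x, D x * (F x - f x) ∂μ| ≤ ε * A := by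
      rw [← setIntegral_eq_integral_of_forall_compl_eq_zero (s := K')
        (fun y hy => by rw [hF0 y hy, hfK' y hy]; simp), ← integral_const_mul,
        ← Real.norm_eq_abs]
      refine norm_integral_le_of_norm_le (hA.const_mul ε) (ae_of_all _ fun x => ?_)
      rw [Real.norm_eq_abs, abs_mul, mul_comm]
      exact mul_le_mul_of_nonneg_right (hFf x).1 (abs_nonneg _)
    have e2 : |∫ x, (dirDeriv F x (Y x) - dirDeriv f x (Y x)) ∂μ| ≤ (ε + ε) * B := by
      rw [← setIntegral_eq_integral_of_forall_compl_eq_zero (s := K')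
        (fun y hy => by rw [hF3 y hy, hf3 y hy]; simp), ← integral_const_mul,
        ← Real.norm_eq_abs]
      exact norm_integral_le_of_norm_le (hB.const_mul _) (ae_of_all _ fun x => (hFf x).2 _)
    have e3 : ∫ x, D x * (F x - f x) ∂μ = ∫ x, D x * F x ∂μ - ∫ x, D x * f x ∂μ := by
      rw [← integral_sub hF1 hf1]; simp_rw [mul_sub]
    have e4 := integral_sub hF2 hf2
    rw [e3] at e1
    rw [e4] at e2
    have e5 : ∫ x, D x * f x ∂μ + ∫ x, dirDeriv f x (Y x) ∂μ =
        -(∫ x, D x * F x ∂μ - ∫ x, D x * f x ∂μ) -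
          (∫ x, dirDeriv F x (Y x) ∂μ - ∫ x, dirDeriv f x (Y x) ∂μ) := by rw [e]; ring
    rw [e5]
    refine (abs_sub _ _).trans ?_
    rw [abs_neg]
    linarith
  have h0 : |∫ x, D x * f x ∂μ + ∫ x, dirDeriv f x (Y x) ∂μ| ≤ 0 := by
    refine le_of_forall_pos_le_add fun η hη => ?_
    refine (key (η / (A + 2 * B + 1)) (by positivity)).trans ?_
    rw [zero_add, div_mul_eq_mul_div, div_le_iff₀ (by positivity)]
    nlinarith
  linarith [abs_nonpos_iff.1 h0]

end TestFunctions

/-! ### Truncated entropy functions. -/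

section Truncation

/-- A trapezoidal cutoff: `1` on `|s| ≤ n - 1`, `0` on `|s| ≥ n`. -/
noncomputable def trapezoid (n : ℕ) (s : ℝ) : ℝ := max 0 (min 1 (n - |s|))

/-- A bounded truncation of the identity, the logarithm in the variable `z = log r`. -/
noncomputable def truncLog (n : ℕ) (z : ℝ) : ℝ := ∫ s in (0 : ℝ)..z, trapezoid n s

/-- A bounded truncation of `1 - exp`. -/
noncomputable def truncExp (n : ℕ) (z : ℝ) : ℝ := ∫ s in (0 : ℝ)..z, -(trapezoid n s * Real.exp s)

theorem continuous_trapezoid (n : ℕ) : Continuous (trapezoid n) := by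
  unfold trapezoid; fun_prop

theorem trapezoid_nonneg (n : ℕ) (s : ℝ) : 0 ≤ trapezoid n s := le_max_left _ _

theorem trapezoid_le_one (n : ℕ) (s : ℝ) : trapezoid n s ≤ 1 :=
  max_le zero_le_one (min_le_left _ _)

theorem monotone_trapezoid (s : ℝ) : Monotone fun n => trapezoid n s := fun n m h => by
  have : (n : ℝ) ≤ m := by exact_mod_cast h
  exact max_le_max le_rfl (min_le_min le_rfl (by linarith))

theorem trapezoid_eq_one {n : ℕ} {s : ℝ} (h : |s| + 1 ≤ n) : trapezoid n s = 1 := by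
  unfold trapezoid
  rw [min_eq_left (by linarith), max_eq_right zero_le_one]

theorem tendsto_trapezoid (s : ℝ) : Tendsto (fun n => trapezoid n s) atTop (𝓝 1) := by
  refine tendsto_const_nhds.congr' ?_
  filter_upwards [eventually_ge_atTop ⌈|s| + 1⌉₊] with n hn
  exact (trapezoid_eq_one (Nat.ceil_le.1 hn)).symm

theorem trapezoid_zero (s : ℝ) : trapezoid 0 s = 0 := by
  unfold trapezoid
  rw [max_eq_left]
  exact (min_le_right _ _).trans (by simp)

theorem hasCompactSupport_trapezoid (n : ℕ) : HasCompactSupport (trapezoid n) := by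
  refine HasCompactSupport.intro (isCompact_closedBall (0 : ℝ) n) fun s hs => ?_
  rw [mem_closedBall_zero_iff, Real.norm_eq_abs, not_le] at hs
  exact max_eq_left ((min_le_right _ _).trans (by linarith))

theorem hasDerivAt_truncLog (n : ℕ) (z : ℝ) : HasDerivAt (truncLog n) (trapezoid n z) z :=
  (continuous_trapezoid n).integral_hasStrictDerivAt 0 z |>.hasDerivAt

theorem hasDerivAt_truncExp (n : ℕ) (z : ℝ) :
    HasDerivAt (truncExp n) (-(trapezoid n z * Real.exp z)) z :=
  ((continuous_trapezoid n).mul Real.continuous_exp).neg.integral_hasStrictDerivAt 0 z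
    |>.hasDerivAt

theorem contDiff_one_of_hasDerivAt {f f' : ℝ → ℝ} (h : ∀ z, HasDerivAt f (f' z) z)
    (hf' : Continuous f') : ContDiff ℝ 1 f :=
  contDiff_one_iff_deriv.2 ⟨fun z => (h z).differentiableAt, by
    rwa [show deriv f = f' from funext fun z => (h z).deriv]⟩

theorem exists_abs_integral_le {g : ℝ → ℝ} (hg : Continuous g) (hgc : HasCompactSupport g) :
    ∃ B, ∀ z, |∫ s in (0 : ℝ)..z, g s| ≤ B := by
  have hi : Integrable (fun s => ‖g s‖) := (hg.integrable_of_hasCompactSupport hgc).norm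
  refine ⟨∫ s, ‖g s‖, fun z => ?_⟩
  exact intervalIntegral.norm_integral_le_integral_norm_uIoc.trans
    (setIntegral_le_integral hi (ae_of_all _ fun s => norm_nonneg _))

theorem exists_abs_trunc_le (n : ℕ) :
    ∃ B, 0 ≤ B ∧ (∀ z, |truncLog n z| ≤ B) ∧ ∀ z, |truncExp n z| ≤ B := by
  obtain ⟨B, hB⟩ := exists_abs_integral_le (continuous_trapezoid n) (hasCompactSupport_trapezoid n)
  obtain ⟨B', hB'⟩ := exists_abs_integral_le
    ((continuous_trapezoid n).mul Real.continuous_exp).neg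
    (hasCompactSupport_trapezoid n).mul_right.neg
  exact ⟨max B B', le_max_of_le_left ((abs_nonneg _).trans (hB 0)),
    fun z => (hB z).trans (le_max_left _ _), fun z => (hB' z).trans (le_max_right _ _)⟩

theorem truncLog_zero (n : ℕ) : truncLog n 0 = 0 := intervalIntegral.integral_same

theorem truncExp_zero (n : ℕ) : truncExp n 0 = 0 := intervalIntegral.integral_same

/-- The truncated entropy function, in the variable `z = log r`. -/
noncomputable def truncKL (n : ℕ) (z : ℝ) : ℝ := Real.exp z * truncLog n z + truncExp n z

/-- In this form the entropy is visibly increasing in the weight: for `s` between `0` and `z`, the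
factor `e^z - e^s` has the sign of the orientation of the integral. -/
theorem truncKL_eq_integral (n : ℕ) (z : ℝ) :
    truncKL n z = ∫ s in (0 : ℝ)..z, trapezoid n s * (Real.exp z - Real.exp s) := by
  have h1 : IntervalIntegrable (fun s => Real.exp z * trapezoid n s) volume 0 z :=
    ((continuous_const.mul (continuous_trapezoid n))).intervalIntegrable _ _
  have h2 : IntervalIntegrable (fun s => -(trapezoid n s * Real.exp s)) volume 0 z :=
    ((continuous_trapezoid n).mul Real.continuous_exp).neg.intervalIntegrable _ _
  unfold truncKL truncLog truncExp
  rw [← intervalIntegral.integral_const_mul, ← intervalIntegral.integral_add h1 h2]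
  congr 1; ext s; ring

theorem monotone_truncKL (z : ℝ) : Monotone fun n => truncKL n z := fun n m h => by
  have hc : ∀ n, Continuous fun s => trapezoid n s * (Real.exp z - Real.exp s) := fun n =>
    (continuous_trapezoid n).mul (by fun_prop)
  simp only [truncKL_eq_integral]
  rcases le_total 0 z with hz | hz
  · refine intervalIntegral.integral_mono_on hz ((hc n).intervalIntegrable _ _)
      ((hc m).intervalIntegrable _ _) fun s hs => ?_
    exact mul_le_mul_of_nonneg_right (monotone_trapezoid s h)
      (sub_nonneg.2 (Real.exp_le_exp.2 hs.2))
  · rw [intervalIntegral.integral_symm z 0, intervalIntegral.integral_symm z 0, neg_le_neg_iff]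
    refine intervalIntegral.integral_mono_on hz ((hc m).intervalIntegrable _ _)
      ((hc n).intervalIntegrable _ _) fun s hs => ?_
    exact mul_le_mul_of_nonpos_right (monotone_trapezoid s h)
      (sub_nonpos.2 (Real.exp_le_exp.2 hs.1))

theorem truncKL_nonneg (n : ℕ) (z : ℝ) : 0 ≤ truncKL n z := by
  -- The weight with index `0` vanishes identically, so the sequence starts from zero.
  have h := monotone_truncKL z (Nat.zero_le n)
  simpa [truncKL_eq_integral 0, trapezoid_zero] using h

theorem truncKL_eq_klFun {n : ℕ} {z : ℝ} (h : |z| + 1 ≤ n) :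
    truncKL n z = InformationTheory.klFun (Real.exp z) := by
  have h1 : ∀ s ∈ uIcc 0 z, trapezoid n s = 1 := fun s hs => by
    refine trapezoid_eq_one (le_trans ?_ h)
    have := abs_sub_left_of_mem_uIcc hs
    simp only [sub_zero] at this
    linarith
  have e1 : truncLog n z = z := by
    unfold truncLog
    rw [intervalIntegral.integral_congr (g := fun _ => 1) h1]; simp
  have e2 : truncExp n z = 1 - Real.exp z := by
    unfold truncExp
    rw [intervalIntegral.integral_congr (g := fun s => -Real.exp s)
      fun s hs => by simp only [h1 s hs, one_mul]]
    simp
  rw [truncKL, e1, e2, InformationTheory.klFun_apply, Real.log_exp]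
  ring

theorem tendsto_truncKL (z : ℝ) :
    Tendsto (fun n => truncKL n z) atTop (𝓝 (InformationTheory.klFun (Real.exp z))) := by
  refine tendsto_const_nhds.congr' ?_
  filter_upwards [eventually_ge_atTop ⌈|z| + 1⌉₊] with n hn
  exact (truncKL_eq_klFun (Nat.ceil_le.1 hn)).symm

end Truncation

/-! ### Kullback-Leibler divergence of measures with densities. -/

section KL

variable {X : Type*} [MeasurableSpace X]

theorem klDiv_withDensity_ofReal {μ : Measure X} {p q : X → ℝ}
    (hp : Measurable p) (hq : Measurable q) (hp0 : ∀ x, 0 < p x) (hq0 : ∀ x, 0 < q x)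
    [IsFiniteMeasure (μ.withDensity fun x => ENNReal.ofReal (p x))]
    [IsFiniteMeasure (μ.withDensity fun x => ENNReal.ofReal (q x))] :
    InformationTheory.klDiv (μ.withDensity fun x => ENNReal.ofReal (p x))
      (μ.withDensity fun x => ENNReal.ofReal (q x)) =
      ∫⁻ x, ENNReal.ofReal (q x * InformationTheory.klFun (p x / q x)) ∂μ := by
  set ν := μ.withDensity fun x => ENNReal.ofReal (q x) with hν
  have hr : Measurable fun x => p x / q x := hp.div hq
  have e : (μ.withDensity fun x => ENNReal.ofReal (p x)) =
      ν.withDensity fun x => ENNReal.ofReal (p x / q x) := by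
    rw [hν, ← withDensity_mul _ hq.ennreal_ofReal hr.ennreal_ofReal]
    congr 1; ext x
    rw [Pi.mul_apply, ← ENNReal.ofReal_mul (hq0 x).le, mul_div_cancel₀ _ (hq0 x).ne']
  have hac : (μ.withDensity fun x => ENNReal.ofReal (p x)) ≪ ν := by
    rw [e]; exact withDensity_absolutelyContinuous _ _
  rw [InformationTheory.klDiv_eq_lintegral_klFun_of_ac hac]
  have hrn : (μ.withDensity fun x => ENNReal.ofReal (p x)).rnDeriv ν =ᵐ[ν]
      fun x => ENNReal.ofReal (p x / q x) := by
    rw [e]; exact Measure.rnDeriv_withDensity ν hr.ennreal_ofReal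
  have e2 : ∫⁻ x, ENNReal.ofReal (InformationTheory.klFun
      ((μ.withDensity fun x => ENNReal.ofReal (p x)).rnDeriv ν x).toReal) ∂ν =
      ∫⁻ x, ENNReal.ofReal (InformationTheory.klFun (p x / q x)) ∂ν := by
    refine lintegral_congr_ae ?_
    filter_upwards [hrn] with x hx
    rw [hx, ENNReal.toReal_ofReal (div_pos (hp0 x) (hq0 x)).le]
  have hm : Measurable fun x => ENNReal.ofReal (InformationTheory.klFun (p x / q x)) :=
    (InformationTheory.measurable_klFun.comp hr).ennreal_ofReal
  rw [e2, hν, lintegral_withDensity_eq_lintegral_mul _ hq.ennreal_ofReal hm]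
  refine lintegral_congr fun x => ?_
  rw [Pi.mul_apply, ← ENNReal.ofReal_mul (hq0 x).le]

/-- The Kullback-Leibler divergence as the limit of truncated entropies. -/
theorem klDiv_eq_ofReal_of_tendsto_truncKL {μ : Measure X} {p q : X → ℝ}
    (hp : Measurable p) (hq : Measurable q) (hp0 : ∀ x, 0 < p x) (hq0 : ∀ x, 0 < q x)
    [IsFiniteMeasure (μ.withDensity fun x => ENNReal.ofReal (p x))]
    [IsFiniteMeasure (μ.withDensity fun x => ENNReal.ofReal (q x))] {I : ℝ}
    (hint : ∀ n, Integrable (fun x => q x * truncKL n (Real.log (p x) - Real.log (q x))) μ)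
    (h : Tendsto (fun n => ∫ x, q x * truncKL n (Real.log (p x) - Real.log (q x)) ∂μ)
      atTop (𝓝 I)) :
    0 ≤ I ∧ InformationTheory.klDiv (μ.withDensity fun x => ENNReal.ofReal (p x))
      (μ.withDensity fun x => ENNReal.ofReal (q x)) = ENNReal.ofReal I := by
  have hnn : ∀ n x, 0 ≤ q x * truncKL n (Real.log (p x) - Real.log (q x)) := fun n x =>
    mul_nonneg (hq0 x).le (truncKL_nonneg n _)
  refine ⟨ge_of_tendsto' h fun n => integral_nonneg (hnn n), ?_⟩
  rw [klDiv_withDensity_ofReal hp hq hp0 hq0]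
  have h1 : Tendsto (fun n => ∫⁻ x, ENNReal.ofReal
      (q x * truncKL n (Real.log (p x) - Real.log (q x))) ∂μ) atTop
      (𝓝 (∫⁻ x, ENNReal.ofReal (q x * InformationTheory.klFun (p x / q x)) ∂μ)) := by
    -- Monotone convergence needs no prior integrability of the entropy; finiteness comes from the
    -- limit `I`.
    refine lintegral_tendsto_of_tendsto_of_monotone
      (fun n => (hint n).aestronglyMeasurable.aemeasurable.ennreal_ofReal)
      (ae_of_all _ fun x n m hnm => ?_) (ae_of_all _ fun x => ?_)
    · exact ENNReal.ofReal_le_ofReal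
        (mul_le_mul_of_nonneg_left (monotone_truncKL _ hnm) (hq0 x).le)
    · refine ENNReal.tendsto_ofReal (Tendsto.const_mul _ ?_)
      have := tendsto_truncKL (Real.log (p x) - Real.log (q x))
      rwa [Real.exp_sub, Real.exp_log (hp0 x), Real.exp_log (hq0 x)] at this
  refine tendsto_nhds_unique h1 ?_
  simp_rw [← ofReal_integral_eq_lintegral_ofReal (hint _) (ae_of_all _ (hnn _))]
  exact ENNReal.tendsto_ofReal h

end KL

/-! ### Finiteness properties deduced from a positive density. -/

section Measure

/-- The density has a positive minimum on a compact set. Local finiteness of the Riemannian measure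
is thus read off from a probability density, without computing in charts. -/
theorem isFiniteMeasureOnCompacts_of_withDensity {X : Type*} [TopologicalSpace X] [T2Space X]
    [MeasurableSpace X] [OpensMeasurableSpace X] {μ : Measure X} {p : X → ℝ} (hp : Continuous p)
    (hp0 : ∀ x, 0 < p x) [IsFiniteMeasure (μ.withDensity fun x => ENNReal.ofReal (p x))] :
    IsFiniteMeasureOnCompacts μ := by
  refine ⟨fun K hK => ?_⟩
  rcases K.eq_empty_or_nonempty with rfl | hne
  · simp
  obtain ⟨x, -, hx⟩ := hK.exists_isMinOn hne hp.continuousOn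
  have h1 : ENNReal.ofReal (p x) * μ K ≤ (μ.withDensity fun x => ENNReal.ofReal (p x)) K := by
    rw [withDensity_apply _ hK.measurableSet, ← setLIntegral_const]
    exact setLIntegral_mono' hK.measurableSet fun y hy => ENNReal.ofReal_le_ofReal (hx hy)
  by_contra htop
  rw [not_lt, top_le_iff] at htop
  rw [htop, ENNReal.mul_top (by simpa using hp0 x), top_le_iff] at h1
  exact measure_ne_top _ _ h1

theorem integrable_of_isFiniteMeasure_withDensity {X : Type*} [MeasurableSpace X] {μ : Measure X}
    {p : X → ℝ} (hp : Measurable p) (hp0 : ∀ x, 0 < p x)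
    [IsFiniteMeasure (μ.withDensity fun x => ENNReal.ofReal (p x))] : Integrable p μ := by
  refine ⟨hp.aestronglyMeasurable, ?_⟩
  rw [hasFiniteIntegral_iff_ofReal (ae_of_all _ fun x => (hp0 x).le)]
  have := measure_lt_top (μ.withDensity fun x => ENNReal.ofReal (p x)) univ
  rwa [withDensity_apply _ MeasurableSet.univ, setLIntegral_univ] at this

end Measure

/-! ### Regular densities and the entropy balance at a fixed time. -/

section Density

variable {d : ℕ} {M : Type*} [MetricSpace M]
  [ChartedSpace (EuclideanSpace ℝ (Fin d)) M]

theorem IsRegularDensity.hasDerivWithinAt {ρ : ℝ → M → ℝ} (hρ : IsRegularDensity (d := d) ρ)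
    {t : ℝ} (ht : t ∈ Icc (0 : ℝ) 1) (x : M) :
    HasDerivWithinAt (fun τ => ρ τ x) (timeDeriv ρ t x) (Icc 0 1) t :=
  (hρ.differentiableOn x t ht).hasDerivWithinAt

/-- On a compact neighbourhood the time derivative is bounded, so `ρ` is Lipschitz in time uniformly
in space; with continuity in space this gives joint continuity. -/
theorem IsRegularDensity.continuousOn {ρ : ℝ → M → ℝ} (hρ : IsRegularDensity (d := d) ρ) :
    ContinuousOn (fun p : ℝ × M => ρ p.1 p.2) (Icc 0 1 ×ˢ univ) := by
  have : LocallyCompactSpace M := ChartedSpace.locallyCompactSpace (EuclideanSpace ℝ (Fin d)) M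
  rintro ⟨t, x⟩ ⟨ht, -⟩
  obtain ⟨K, hK, hxK⟩ := exists_compact_mem_nhds x
  obtain ⟨C, hC⟩ := (isCompact_Icc.prod hK).exists_bound_of_continuousOn
    (hρ.continuousOn_timeDeriv.mono (prod_mono le_rfl (subset_univ K)))
  have h : ContinuousOn (fun p : ℝ × M => ρ p.1 p.2) (Icc 0 1 ×ˢ K) := by
    refine continuousOn_prod_of_continuousOn_lipschitzOnWith _ C.toNNReal
      (fun s hs => (hρ.contMDiff s hs).continuous.continuousOn) fun y hy => ?_
    refine LipschitzOnWith.of_dist_le_mul fun s hs s' hs' => ?_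
    rw [dist_eq_norm, dist_eq_norm]
    refine (convex_Icc (0 : ℝ) 1).norm_image_sub_le_of_norm_derivWithin_le (hρ.differentiableOn y)
      (fun τ hτ => (hC (τ, y) ⟨hτ, hy⟩).trans (Real.le_coe_toNNReal C)) hs' hs
  refine (h (t, x) ⟨ht, mem_of_mem_nhds hxK⟩).mono_of_mem_nhdsWithin ?_
  rw [nhdsWithin_prod_eq, nhdsWithin_univ]
  exact prod_mem_prod self_mem_nhdsWithin hxK

/-- The logarithm of the ratio of two densities. -/
noncomputable def logRatio {X : Type*} (p q : X → ℝ) (x : X) : ℝ := Real.log (p x) - Real.log (q x)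

theorem exp_logRatio {X : Type*} {p q : X → ℝ} (hp : ∀ x, 0 < p x) (hq : ∀ x, 0 < q x) (x : X) :
    q x * Real.exp (logRatio p q x) = p x := by
  rw [logRatio, Real.exp_sub, Real.exp_log (hp x), Real.exp_log (hq x),
    mul_div_cancel₀ _ (hq x).ne']

/-- The density of the truncated entropy. -/
noncomputable def truncEntropy {X : Type*} (n : ℕ) (p q : X → ℝ) (x : X) : ℝ :=
  p x * truncLog n (logRatio p q x) + q x * truncExp n (logRatio p q x)

theorem truncEntropy_eq {X : Type*} {p q : X → ℝ} (hp : ∀ x, 0 < p x) (hq : ∀ x, 0 < q x)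
    (n : ℕ) (x : X) :
    truncEntropy n p q x = q x * truncKL n (logRatio p q x) := by
  rw [truncEntropy, truncKL, mul_add, ← mul_assoc, exp_logRatio hp hq]

theorem contMDiff_log {p : M → ℝ} (hp : ContMDiff (𝓡 d) 𝓘(ℝ, ℝ) 1 p) (hp0 : ∀ x, 0 < p x) :
    ContMDiff (𝓡 d) 𝓘(ℝ, ℝ) 1 fun x => Real.log (p x) := fun x =>
  (Real.contDiffAt_log.2 (hp0 x).ne').contMDiffAt.comp x (hp x)

theorem contMDiff_logRatio {p q : M → ℝ} (hp : ContMDiff (𝓡 d) 𝓘(ℝ, ℝ) 1 p)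
    (hq : ContMDiff (𝓡 d) 𝓘(ℝ, ℝ) 1 q) (hp0 : ∀ x, 0 < p x) (hq0 : ∀ x, 0 < q x) :
    ContMDiff (𝓡 d) 𝓘(ℝ, ℝ) 1 (logRatio p q) :=
  (contMDiff_log hp hp0).sub (contMDiff_log hq hq0)

variable [RiemannianBundle (fun x : M => TangentSpace (𝓡 d) x)]

theorem inner_grad_eq_dirDeriv (f : M → ℝ) (x : M) (w : TangentSpace (𝓡 d) x) :
    inner ℝ (grad (d := d) f x) w = dirDeriv f x w := inner_grad f x w

theorem klIntegrand_eq {ρ ρ' : ℝ → M → ℝ} (v v' : ℝ → (x : M) → TangentSpace (𝓡 d) x)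
    {t : ℝ} (hp : ContMDiff (𝓡 d) 𝓘(ℝ, ℝ) 1 (ρ t)) (hq : ContMDiff (𝓡 d) 𝓘(ℝ, ℝ) 1 (ρ' t))
    (hp0 : ∀ x, 0 < ρ t x) (hq0 : ∀ x, 0 < ρ' t x) (x : M) :
    klIntegrand ρ ρ' v v' t x =
      (dirDeriv (logRatio (ρ t) (ρ' t)) x (v t x) - dirDeriv (logRatio (ρ t) (ρ' t)) x (v' t x))
        * ρ t x := by
  have h1 : ∀ w : TangentSpace (𝓡 d) x, dirDeriv (logRatio (ρ t) (ρ' t)) x w =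
      dirDeriv (fun y => Real.log (ρ t y)) x w - dirDeriv (fun y => Real.log (ρ' t y)) x w :=
    fun w => dirDeriv_sub ((contMDiff_log hp hp0).mdifferentiable one_ne_zero x)
      ((contMDiff_log hq hq0).mdifferentiable one_ne_zero x) w
  rw [klIntegrand, score, score, inner_sub_right, inner_sub_left, inner_sub_left,
    inner_grad_eq_dirDeriv, inner_grad_eq_dirDeriv, inner_grad_eq_dirDeriv,
    inner_grad_eq_dirDeriv, h1, h1]

variable [IsManifold (𝓡 d) ∞ M]
  [IsContinuousRiemannianBundle (EuclideanSpace ℝ (Fin d)) (fun x : M => TangentSpace (𝓡 d) x)]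
  [SigmaCompactSpace M] [MeasurableSpace M] [BorelSpace M]

theorem integral_mul_eq_of_hasDivergence [IsFiniteMeasureOnCompacts (riemVolume d M)]
    {p a : M → ℝ} {V : (x : M) → TangentSpace (𝓡 d) x} (hp : ContMDiff (𝓡 d) 𝓘(ℝ, ℝ) 1 p)
    (ha : Continuous a)
    (hV : Continuous fun x : M => (⟨x, V x⟩ : TotalSpace (EuclideanSpace ℝ (Fin d))
      (fun x : M => TangentSpace (𝓡 d) x)))
    (hdiv : HasDivergence (fun x => p x • V x) (fun x => - a x))
    {f : M → ℝ} (hf : ContMDiff (𝓡 d) 𝓘(ℝ, ℝ) 1 f) (hfc : HasCompactSupport f) :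
    ∫ x, a x * f x ∂(riemVolume d M) = ∫ x, p x * dirDeriv f x (V x) ∂(riemVolume d M) := by
  have h := hdiv.integral_eq (fun g hg => by
      simp_rw [dirDeriv_smul_vec]
      exact hp.continuous.mul (continuous_dirDeriv hg hV))
    (by
      simp_rw [norm_smul, Real.norm_eq_abs]
      exact hp.continuous.abs.mul (continuous_norm_section hV)) ha.neg hf hfc
  simp_rw [dirDeriv_smul_vec, neg_mul] at h
  rw [integral_neg] at h
  exact neg_injective h

/-- The rate of change of the localized truncated entropy, up to the flux through the cutoff. -/
theorem abs_integral_entropy_rate_sub_le [IsFiniteMeasureOnCompacts (riemVolume d M)]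
    {p q a b : M → ℝ} {V W : (x : M) → TangentSpace (𝓡 d) x}
    (hp : ContMDiff (𝓡 d) 𝓘(ℝ, ℝ) 1 p) (hq : ContMDiff (𝓡 d) 𝓘(ℝ, ℝ) 1 q)
    (hp0 : ∀ x, 0 < p x) (hq0 : ∀ x, 0 < q x) (ha : Continuous a) (hb : Continuous b)
    (hV : Continuous fun x : M => (⟨x, V x⟩ : TotalSpace (EuclideanSpace ℝ (Fin d))
      (fun x : M => TangentSpace (𝓡 d) x)))
    (hW : Continuous fun x : M => (⟨x, W x⟩ : TotalSpace (EuclideanSpace ℝ (Fin d))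
      (fun x : M => TangentSpace (𝓡 d) x)))
    (hdivV : HasDivergence (fun x => p x • V x) (fun x => - a x))
    (hdivW : HasDivergence (fun x => q x • W x) (fun x => - b x))
    (hVi : Integrable (fun x => ‖V x‖ * p x) (riemVolume d M))
    (hWi : Integrable (fun x => ‖W x‖ * q x) (riemVolume d M))
    {χ : M → ℝ} (hχ : ContMDiff (𝓡 d) 𝓘(ℝ, ℝ) ∞ χ) (hχc : HasCompactSupport χ)
    {c : ℝ} (hc : ∀ y, ∀ w : TangentSpace (𝓡 d) y, |dirDeriv χ y w| ≤ c * ‖w‖) {n : ℕ} {B : ℝ}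
    (hN : ∀ z, |truncLog n z| ≤ B) (hQ : ∀ z, |truncExp n z| ≤ B) :
    |∫ x, χ x * (a x * truncLog n (logRatio p q x) + b x * truncExp n (logRatio p q x))
        ∂(riemVolume d M) -
      ∫ x, χ x * (trapezoid n (logRatio p q x) *
        ((dirDeriv (logRatio p q) x (V x) - dirDeriv (logRatio p q) x (W x)) * p x))
        ∂(riemVolume d M)| ≤
      B * c * (∫ x, ‖V x‖ * p x ∂(riemVolume d M) + ∫ x, ‖W x‖ * q x ∂(riemVolume d M)) := by
  set μ := riemVolume d M
  have hz := contMDiff_logRatio hp hq hp0 hq0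
  set z := logRatio p q
  have hχ1 : ContMDiff (𝓡 d) 𝓘(ℝ, ℝ) 1 χ := hχ.of_le (by simp)
  have hzd : MDifferentiable (𝓡 d) 𝓘(ℝ, ℝ) z := hz.mdifferentiable one_ne_zero
  have hχd : MDifferentiable (𝓡 d) 𝓘(ℝ, ℝ) χ := hχ1.mdifferentiable one_ne_zero
  have hη : Continuous fun x => trapezoid n (z x) := (continuous_trapezoid n).comp hz.continuous
  have hNc : ContMDiff (𝓡 d) 𝓘(ℝ, ℝ) 1 fun x => truncLog n (z x) :=
    (contDiff_one_of_hasDerivAt (hasDerivAt_truncLog n) (continuous_trapezoid n)).contMDiff.comp hz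
  have hQc : ContMDiff (𝓡 d) 𝓘(ℝ, ℝ) 1 fun x => truncExp n (z x) :=
    (contDiff_one_of_hasDerivAt (hasDerivAt_truncExp n)
      ((continuous_trapezoid n).mul Real.continuous_exp).neg).contMDiff.comp hz
  have hf1 : ContMDiff (𝓡 d) 𝓘(ℝ, ℝ) 1 fun x => χ x * truncLog n (z x) := hχ1.mul hNc
  have hf2 : ContMDiff (𝓡 d) 𝓘(ℝ, ℝ) 1 fun x => χ x * truncExp n (z x) := hχ1.mul hQc
  have hi : ∀ g : M → ℝ, Continuous g → Integrable (fun x => χ x * g x) μ := fun g hg =>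
    (hχ.continuous.mul hg).integrable_of_hasCompactSupport hχc.mul_right
  have hd0 : ∀ g : M → ℝ, ∀ y ∉ tsupport χ, ∀ w : TangentSpace (𝓡 d) y,
      dirDeriv (fun x => χ x * g x) y w = 0 := fun g y hy w => by
    refine (dirDeriv_congr (g := fun _ => 0) ?_ w).trans (dirDeriv_const 0 y w)
    filter_upwards [(isClosed_tsupport χ).isOpen_compl.mem_nhds hy] with x hx
    rw [image_eq_zero_of_notMem_tsupport hx, zero_mul]
  have hG1 : Integrable (fun x => p x * dirDeriv (fun y => χ y * truncLog n (z y)) x (V x)) μ :=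
    (hp.continuous.mul (continuous_dirDeriv hf1 hV)).integrable_of_hasCompactSupport
      (HasCompactSupport.intro hχc fun x hx => 
        mul_eq_zero_of_right _ (hd0 (fun y => truncLog n (z y)) x hx _))
  have hG2 : Integrable (fun x => q x * dirDeriv (fun y => χ y * truncExp n (z y)) x (W x)) μ :=
    (hq.continuous.mul (continuous_dirDeriv hf2 hW)).integrable_of_hasCompactSupport
      (HasCompactSupport.intro hχc fun x hx => 
        mul_eq_zero_of_right _ (hd0 (fun y => truncExp n (z y)) x hx _))
  have hA : Integrable (fun x => χ x * (trapezoid n (z x) *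
      ((dirDeriv z x (V x) - dirDeriv z x (W x)) * p x))) μ :=
    hi _ (hη.mul (((continuous_dirDeriv hz hV).sub (continuous_dirDeriv hz hW)).mul hp.continuous))
  -- The transport equations, tested against `χ truncLog n (z)` and `χ truncExp n (z)`.
  have e1 : ∫ x, χ x * (a x * truncLog n (z x) + b x * truncExp n (z x)) ∂μ =
      ∫ x, p x * dirDeriv (fun y => χ y * truncLog n (z y)) x (V x) ∂μ +
      ∫ x, q x * dirDeriv (fun y => χ y * truncExp n (z y)) x (W x) ∂μ := by
    rw [← integral_mul_eq_of_hasDivergence hp ha hV hdivV hf1 hχc.mul_right,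
      ← integral_mul_eq_of_hasDivergence hq hb hW hdivW hf2 hχc.mul_right, ← integral_add]
    · congr 1; ext x; ring
    · exact (hi _ (ha.mul hNc.continuous)).congr (ae_of_all _ fun x => by simp only [Pi.mul_apply]; ring)
    · exact (hi _ (hb.mul hQc.continuous)).congr (ae_of_all _ fun x => by simp only [Pi.mul_apply]; ring)
  rw [e1, ← integral_add hG1 hG2, ← integral_sub (by exact hG1.add hG2) hA,
    ← integral_add hVi hWi, ← integral_const_mul, ← Real.norm_eq_abs]
  refine norm_integral_le_of_norm_le ((hVi.add hWi).const_mul _) (ae_of_all _ fun x => ?_)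
  have d1 : ∀ w : TangentSpace (𝓡 d) x, dirDeriv (fun y => χ y * truncLog n (z y)) x w =
      χ x * (trapezoid n (z x) * dirDeriv z x w) + truncLog n (z x) * dirDeriv χ x w := fun w => by
    rw [dirDeriv_mul (hχd x) (hNc.mdifferentiable one_ne_zero x),
      dirDeriv_comp (hasDerivAt_truncLog n (z x)) (hzd x)]
  have d2 : ∀ w : TangentSpace (𝓡 d) x, dirDeriv (fun y => χ y * truncExp n (z y)) x w =
      χ x * (-(trapezoid n (z x) * Real.exp (z x)) * dirDeriv z x w) +
        truncExp n (z x) * dirDeriv χ x w := fun w => by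
    rw [dirDeriv_mul (hχd x) (hQc.mdifferentiable one_ne_zero x),
      dirDeriv_comp (hasDerivAt_truncExp n (z x)) (hzd x)]
  have hpq : q x * Real.exp (z x) = p x := exp_logRatio hp0 hq0 x
  -- By `q e^z = p` the terms in `dz` reproduce the main integrand exactly; only those in `dχ`
  -- remain.
  have e2 : p x * dirDeriv (fun y => χ y * truncLog n (z y)) x (V x) +
      q x * dirDeriv (fun y => χ y * truncExp n (z y)) x (W x) -
      χ x * (trapezoid n (z x) * ((dirDeriv z x (V x) - dirDeriv z x (W x)) * p x)) =
      truncLog n (z x) * dirDeriv χ x (V x) * p x + truncExp n (z x) * dirDeriv χ x (W x) * q x := by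
    rw [d1, d2, ← hpq]; ring
  have hB : 0 ≤ B := (abs_nonneg _).trans (hN 0)
  rw [e2, Real.norm_eq_abs]
  refine (abs_add_le _ _).trans ?_
  rw [abs_mul, abs_mul, abs_mul, abs_mul, abs_of_pos (hp0 x), abs_of_pos (hq0 x), mul_add]
  refine add_le_add ?_ ?_
  · calc _ ≤ B * (c * ‖V x‖) * p x := mul_le_mul_of_nonneg_right
          (mul_le_mul (hN _) (hc x _) (abs_nonneg _) hB) (hp0 x).le
      _ = _ := by ring
  · calc _ ≤ B * (c * ‖W x‖) * q x := mul_le_mul_of_nonneg_right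
          (mul_le_mul (hQ _) (hc x _) (abs_nonneg _) hB) (hq0 x).le
      _ = _ := by ring

end Density

/-! ### Integration in time and removal of the cutoff. -/

section TimeIntegral

variable {d : ℕ} {M : Type*} [MetricSpace M]
  [ChartedSpace (EuclideanSpace ℝ (Fin d)) M]

theorem continuousOn_logRatio {ρ ρ' : ℝ → M → ℝ} (hρ : IsRegularDensity (d := d) ρ)
    (hρ' : IsRegularDensity (d := d) ρ') :
    ContinuousOn (fun p : ℝ × M => logRatio (ρ p.1) (ρ' p.1) p.2) (Icc 0 1 ×ˢ univ) :=
  (hρ.continuousOn.log fun p hp => (hρ.pos p.1 hp.1 p.2).ne').sub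
    (hρ'.continuousOn.log fun p hp => (hρ'.pos p.1 hp.1 p.2).ne')

/-- The time derivative of the truncated entropy density. -/
noncomputable def entropyRate (n : ℕ) (ρ ρ' : ℝ → M → ℝ) (t : ℝ) (x : M) : ℝ :=
  timeDeriv ρ t x * truncLog n (logRatio (ρ t) (ρ' t) x) +
    timeDeriv ρ' t x * truncExp n (logRatio (ρ t) (ρ' t) x)

theorem continuous_truncLog (n : ℕ) : Continuous (truncLog n) :=
  continuous_iff_continuousAt.2 fun z => (hasDerivAt_truncLog n z).continuousAt

theorem continuous_truncExp (n : ℕ) : Continuous (truncExp n) :=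
  continuous_iff_continuousAt.2 fun z => (hasDerivAt_truncExp n z).continuousAt

theorem continuousOn_entropyRate {ρ ρ' : ℝ → M → ℝ} (hρ : IsRegularDensity (d := d) ρ)
    (hρ' : IsRegularDensity (d := d) ρ') (n : ℕ) :
    ContinuousOn (fun p : ℝ × M => entropyRate n ρ ρ' p.1 p.2) (Icc 0 1 ×ˢ univ) :=
  (hρ.continuousOn_timeDeriv.mul
    ((continuous_truncLog n).comp_continuousOn (continuousOn_logRatio hρ hρ'))).add
  (hρ'.continuousOn_timeDeriv.mul
    ((continuous_truncExp n).comp_continuousOn (continuousOn_logRatio hρ hρ')))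

/-- The contributions of `∂_t z` are `ρ η_n` and `-ρ' η_n e^z` times `∂_t z` and cancel; `truncExp`
is paired with `truncLog` for this purpose. -/
theorem hasDerivWithinAt_truncEntropy {ρ ρ' : ℝ → M → ℝ} (hρ : IsRegularDensity (d := d) ρ)
    (hρ' : IsRegularDensity (d := d) ρ') (n : ℕ) {t : ℝ} (ht : t ∈ Icc (0 : ℝ) 1) (x : M) :
    HasDerivWithinAt (fun τ => truncEntropy n (ρ τ) (ρ' τ) x) (entropyRate n ρ ρ' t x)
      (Icc 0 1) t := by
  have hp := hρ.hasDerivWithinAt ht x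
  have hq := hρ'.hasDerivWithinAt ht x
  have hz : HasDerivWithinAt (fun τ => logRatio (ρ τ) (ρ' τ) x) _ (Icc 0 1) t :=
    (hp.log (hρ.pos t ht x).ne').sub (hq.log (hρ'.pos t ht x).ne')
  have h := (hp.mul ((hasDerivAt_truncLog n _).comp_hasDerivWithinAt t hz)).add
    (hq.mul ((hasDerivAt_truncExp n _).comp_hasDerivWithinAt t hz))
  refine h.congr_deriv ?_
  have e := exp_logRatio (hρ.pos t ht) (hρ'.pos t ht) x
  simp only [entropyRate, Function.comp]
  rw [← e]
  ring

theorem integral_entropyRate {ρ ρ' : ℝ → M → ℝ} (hρ : IsRegularDensity (d := d) ρ)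
    (hρ' : IsRegularDensity (d := d) ρ') (n : ℕ) (x : M) :
    ∫ t in Icc (0 : ℝ) 1, entropyRate n ρ ρ' t x =
      truncEntropy n (ρ 1) (ρ' 1) x - truncEntropy n (ρ 0) (ρ' 0) x := by
  have hc : ContinuousOn (fun t => entropyRate n ρ ρ' t x) (Icc 0 1) :=
    (continuousOn_entropyRate hρ hρ' n).comp (f := fun t : ℝ => (t, x)) (by fun_prop)
      fun t ht => ⟨ht, mem_univ x⟩
  rw [integral_Icc_eq_integral_Ioc, ← intervalIntegral.integral_of_le zero_le_one]
  refine intervalIntegral.integral_eq_sub_of_hasDerivAt_of_le zero_le_one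
    (fun t ht => (hasDerivWithinAt_truncEntropy hρ hρ' n ht x).continuousWithinAt)
    (fun t ht => (hasDerivWithinAt_truncEntropy hρ hρ' n (Ioo_subset_Icc_self ht) x).hasDerivAt
      (Icc_mem_nhds ht.1 ht.2)) ?_
  exact ContinuousOn.intervalIntegrable (by rwa [uIcc_of_le zero_le_one])

theorem continuous_timeDeriv {ρ : ℝ → M → ℝ} (hρ : IsRegularDensity (d := d) ρ) {t : ℝ}
    (ht : t ∈ Icc (0 : ℝ) 1) : Continuous (timeDeriv ρ t) := by
  rw [← continuousOn_univ]
  exact hρ.continuousOn_timeDeriv.comp (f := fun x : M => (t, x)) (by fun_prop)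
    fun x _ => ⟨ht, mem_univ x⟩

theorem prod_restrict_Icc_univ {X : Type*} [MeasurableSpace X] (μ : Measure X) [SFinite μ] :
    ((volume : Measure ℝ).prod μ).restrict (Icc 0 1 ×ˢ univ) =
      ((volume : Measure ℝ).restrict (Icc 0 1)).prod μ := by
  rw [← Measure.prod_restrict, Measure.restrict_univ]

variable [IsManifold (𝓡 d) ∞ M] [RiemannianBundle (fun x : M => TangentSpace (𝓡 d) x)]
  [IsContinuousRiemannianBundle (EuclideanSpace ℝ (Fin d)) (fun x : M => TangentSpace (𝓡 d) x)]
  [SigmaCompactSpace M] [MeasurableSpace M] [BorelSpace M]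

/-- The localized truncated entropy balance between the times `0` and `1`. -/
theorem abs_integral_truncEntropy_sub_le [IsFiniteMeasureOnCompacts (riemVolume d M)]
    {ρ ρ' : ℝ → M → ℝ} {v v' : ℝ → (x : M) → TangentSpace (𝓡 d) x}
    (hρ : IsRegularDensity (d := d) ρ) (hρ' : IsRegularDensity (d := d) ρ')
    (hv : IsTimeVectorField v) (hv' : IsTimeVectorField v')
    (hflux : FiniteFlux ρ v) (hflux' : FiniteFlux ρ' v')
    (htransport : SolvesTransport ρ v) (htransport' : SolvesTransport ρ' v')
    (hint : IntegrableOn (fun p : ℝ × M => klIntegrand ρ ρ' v v' p.1 p.2) (Icc 0 1 ×ˢ univ)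
      ((volume : Measure ℝ).prod (riemVolume d M))) {n : ℕ} {B : ℝ}
    (hN : ∀ z, |truncLog n z| ≤ B) (hQ : ∀ z, |truncExp n z| ≤ B)
    {χ : M → ℝ} (hχ : ContMDiff (𝓡 d) 𝓘(ℝ, ℝ) ∞ χ) (hχc : HasCompactSupport χ)
    {C c : ℝ} (hC : ∀ x, |χ x| ≤ C)
    (hc : ∀ y, ∀ w : TangentSpace (𝓡 d) y, |dirDeriv χ y w| ≤ c * ‖w‖) :
    |∫ x, χ x * (truncEntropy n (ρ 1) (ρ' 1) x - truncEntropy n (ρ 0) (ρ' 0) x)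
        ∂(riemVolume d M) -
      ∫ p in Icc 0 1 ×ˢ univ, χ p.2 * (trapezoid n (logRatio (ρ p.1) (ρ' p.1) p.2) *
        klIntegrand ρ ρ' v v' p.1 p.2) ∂((volume : Measure ℝ).prod (riemVolume d M))| ≤
      B * c * ∫ t in Icc (0 : ℝ) 1, (∫ x, ‖v t x‖ * ρ t x ∂(riemVolume d M) +
        ∫ x, ‖v' t x‖ * ρ' t x ∂(riemVolume d M)) := by
  set μ := riemVolume d M
  have hms : MeasurableSet (Icc (0 : ℝ) 1 ×ˢ (univ : Set M)) := measurableSet_Icc.prod .univ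
  unfold FiniteFlux at hflux hflux'
  have hrate : IntegrableOn (fun p : ℝ × M => χ p.2 * entropyRate n ρ ρ' p.1 p.2)
      (Icc 0 1 ×ˢ univ) ((volume : Measure ℝ).prod μ) := by
    have hco : ContinuousOn (fun p : ℝ × M => χ p.2 * entropyRate n ρ ρ' p.1 p.2)
        (Icc 0 1 ×ˢ univ) :=
      (hχ.continuous.comp continuous_snd).continuousOn.mul (continuousOn_entropyRate hρ hρ' n)
    have h1 : IntegrableOn (fun p : ℝ × M => χ p.2 * entropyRate n ρ ρ' p.1 p.2)
        (Icc 0 1 ×ˢ tsupport χ) ((volume : Measure ℝ).prod μ) :=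
      (hco.mono (prod_mono le_rfl (subset_univ _))).integrableOn_compact
        (isCompact_Icc.prod hχc)
    refine h1.of_forall_sdiff_eq_zero hms fun p hp => ?_
    have : p.2 ∉ tsupport χ := fun h => hp.2 ⟨hp.1.1, h⟩
    rw [image_eq_zero_of_notMem_tsupport this, zero_mul]
  have hmain : IntegrableOn (fun p : ℝ × M => χ p.2 *
      (trapezoid n (logRatio (ρ p.1) (ρ' p.1) p.2) * klIntegrand ρ ρ' v v' p.1 p.2))
      (Icc 0 1 ×ˢ univ) ((volume : Measure ℝ).prod μ) := by
    refine Integrable.bdd_mul (c := C) (Integrable.bdd_mul (c := 1) hint ?_ ?_) ?_ ?_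
    · exact ((continuous_trapezoid n).comp_continuousOn
        (continuousOn_logRatio hρ hρ')).aestronglyMeasurable hms
    · refine ae_of_all _ fun p => ?_
      rw [Real.norm_eq_abs, abs_of_nonneg (trapezoid_nonneg _ _)]
      exact trapezoid_le_one _ _
    · exact (hχ.continuous.comp continuous_snd).aestronglyMeasurable
    · exact ae_of_all _ fun p => hC p.2
  unfold IntegrableOn at hrate hmain hflux hflux'
  rw [prod_restrict_Icc_univ] at hrate hmain hflux hflux' ⊢
  have e1 : ∫ x, χ x * (truncEntropy n (ρ 1) (ρ' 1) x - truncEntropy n (ρ 0) (ρ' 0) x) ∂μ =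
      ∫ t in Icc (0 : ℝ) 1, ∫ x, χ x * entropyRate n ρ ρ' t x ∂μ := by
    rw [integral_integral_swap (f := fun t x => χ x * entropyRate n ρ ρ' t x) hrate]
    congr 1; ext x
    rw [integral_const_mul, integral_entropyRate hρ hρ']
  rw [e1, integral_prod _ hmain, ← integral_sub hrate.integral_prod_left hmain.integral_prod_left,
    ← integral_const_mul, ← Real.norm_eq_abs]
  refine norm_integral_le_of_norm_le
    ((hflux.integral_prod_left.add hflux'.integral_prod_left).const_mul _) ?_
  -- The fixed-time estimate needs integrable fluxes, which Fubini provides at almost every time.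
  filter_upwards [ae_restrict_mem measurableSet_Icc, hflux.prod_right_ae, hflux'.prod_right_ae]
    with t ht h1 h2
  simp_rw [klIntegrand_eq v v' (hρ.contMDiff t ht) (hρ'.contMDiff t ht) (hρ.pos t ht)
    (hρ'.pos t ht)]
  exact abs_integral_entropy_rate_sub_le (hρ.contMDiff t ht) (hρ'.contMDiff t ht) (hρ.pos t ht)
    (hρ'.pos t ht) (continuous_timeDeriv hρ ht) (continuous_timeDeriv hρ' ht) (hv t ht) (hv' t ht)
    (htransport t ht) (htransport' t ht) h1 h2 hχ hχc hc hN hQ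

/-- The truncated entropy balance between the times `0` and `1`. -/
theorem integral_truncEntropy_eq [IsRiemannianManifold (𝓡 d) M] [CompleteSpace M] [Nonempty M]
    [IsFiniteMeasureOnCompacts (riemVolume d M)]
    {ρ ρ' : ℝ → M → ℝ} {v v' : ℝ → (x : M) → TangentSpace (𝓡 d) x}
    (hρ : IsRegularDensity (d := d) ρ) (hρ' : IsRegularDensity (d := d) ρ')
    (hi : Integrable (ρ 1) (riemVolume d M)) (hi' : Integrable (ρ' 1) (riemVolume d M))
    (h0 : ρ 0 =ᵐ[riemVolume d M] ρ' 0)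
    (hv : IsTimeVectorField v) (hv' : IsTimeVectorField v')
    (hflux : FiniteFlux ρ v) (hflux' : FiniteFlux ρ' v')
    (htransport : SolvesTransport ρ v) (htransport' : SolvesTransport ρ' v')
    (hint : IntegrableOn (fun p : ℝ × M => klIntegrand ρ ρ' v v' p.1 p.2) (Icc 0 1 ×ˢ univ)
      ((volume : Measure ℝ).prod (riemVolume d M))) (n : ℕ) :
    Integrable (truncEntropy n (ρ 1) (ρ' 1)) (riemVolume d M) ∧
    ∫ x, truncEntropy n (ρ 1) (ρ' 1) x ∂(riemVolume d M) =
      ∫ p in Icc 0 1 ×ˢ univ, trapezoid n (logRatio (ρ p.1) (ρ' p.1) p.2) *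
        klIntegrand ρ ρ' v v' p.1 p.2 ∂((volume : Measure ℝ).prod (riemVolume d M)) := by
  set μ := riemVolume d M
  obtain ⟨B, hB0, hN, hQ⟩ := exists_abs_trunc_le n
  obtain ⟨χ, hχ, hχc, hχ2, hχ1, hχd⟩ := exists_smooth_cutoffs (d := d) (M := M)
  have hms : MeasurableSet (Icc (0 : ℝ) 1 ×ˢ (univ : Set M)) := measurableSet_Icc.prod .univ
  have one_mem : (1 : ℝ) ∈ Icc (0 : ℝ) 1 := ⟨zero_le_one, le_rfl⟩
  have hz : Continuous (logRatio (ρ 1) (ρ' 1)) :=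
    (contMDiff_logRatio (hρ.contMDiff 1 one_mem) (hρ'.contMDiff 1 one_mem) (hρ.pos 1 one_mem)
      (hρ'.pos 1 one_mem)).continuous
  have hE : Integrable (truncEntropy n (ρ 1) (ρ' 1)) μ := by
    refine Integrable.add ?_ ?_
    · exact hi.mul_bdd ((continuous_truncLog n).comp hz).aestronglyMeasurable
        (ae_of_all _ fun x => hN _)
    · exact hi'.mul_bdd ((continuous_truncExp n).comp hz).aestronglyMeasurable
        (ae_of_all _ fun x => hQ _)
  have hη : IntegrableOn (fun p : ℝ × M => trapezoid n (logRatio (ρ p.1) (ρ' p.1) p.2) *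
      klIntegrand ρ ρ' v v' p.1 p.2) (Icc 0 1 ×ˢ univ) ((volume : Measure ℝ).prod μ) := by
    refine Integrable.bdd_mul (c := 1) hint ?_ ?_
    · exact ((continuous_trapezoid n).comp_continuousOn
        (continuousOn_logRatio hρ hρ')).aestronglyMeasurable hms
    · refine ae_of_all _ fun p => ?_
      rw [Real.norm_eq_abs, abs_of_nonneg (trapezoid_nonneg _ _)]
      exact trapezoid_le_one _ _
  refine ⟨hE, ?_⟩
  set F := ∫ t in Icc (0 : ℝ) 1, (∫ x, ‖v t x‖ * ρ t x ∂μ + ∫ x, ‖v' t x‖ * ρ' t x ∂μ)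
  have hk := fun k => abs_integral_truncEntropy_sub_le hρ hρ' hv hv' hflux hflux' htransport
    htransport' hint hN hQ (hχ k) (hχc k) (hχ2 k) (hχd k)
  -- At time `0` the log ratio is zero almost everywhere, and both truncations vanish at `0`.
  have hinit : ∀ k, ∫ x, χ k x * (truncEntropy n (ρ 1) (ρ' 1) x - truncEntropy n (ρ 0) (ρ' 0) x) ∂μ
      = ∫ x, χ k x * truncEntropy n (ρ 1) (ρ' 1) x ∂μ := fun k => by
    refine integral_congr_ae ?_
    filter_upwards [h0] with x hx
    simp [truncEntropy, logRatio, hx, truncLog_zero, truncExp_zero]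
  have t1 : Tendsto (fun k => ∫ x, χ k x * truncEntropy n (ρ 1) (ρ' 1) x ∂μ) atTop
      (𝓝 (∫ x, truncEntropy n (ρ 1) (ρ' 1) x ∂μ)) := by
    refine tendsto_integral_of_dominated_convergence
      (fun x => 2 * ‖truncEntropy n (ρ 1) (ρ' 1) x‖)
      (fun k => (hχ k).continuous.aestronglyMeasurable.mul hE.aestronglyMeasurable)
      (hE.norm.const_mul 2) (fun k => ae_of_all _ fun x => ?_) (ae_of_all _ fun x => ?_)
    · rw [norm_mul]
      exact mul_le_mul_of_nonneg_right (hχ2 k x) (norm_nonneg _)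
    · simpa using (hχ1 x).mul_const (truncEntropy n (ρ 1) (ρ' 1) x)
  have t2 : Tendsto (fun k => ∫ p in Icc 0 1 ×ˢ univ, χ k p.2 *
      (trapezoid n (logRatio (ρ p.1) (ρ' p.1) p.2) * klIntegrand ρ ρ' v v' p.1 p.2)
        ∂((volume : Measure ℝ).prod μ)) atTop
      (𝓝 (∫ p in Icc 0 1 ×ˢ univ, trapezoid n (logRatio (ρ p.1) (ρ' p.1) p.2) *
        klIntegrand ρ ρ' v v' p.1 p.2 ∂((volume : Measure ℝ).prod μ))) := by
    refine tendsto_integral_of_dominated_convergence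
      (fun p => 2 * ‖trapezoid n (logRatio (ρ p.1) (ρ' p.1) p.2) *
        klIntegrand ρ ρ' v v' p.1 p.2‖)
      (fun k => ((hχ k).continuous.comp continuous_snd).aestronglyMeasurable.mul
        hη.aestronglyMeasurable)
      (hη.norm.const_mul 2) (fun k => ae_of_all _ fun p => ?_) (ae_of_all _ fun p => ?_)
    · rw [norm_mul]
      exact mul_le_mul_of_nonneg_right (hχ2 k p.2) (norm_nonneg _)
    · simpa using (hχ1 p.2).mul_const (trapezoid n (logRatio (ρ p.1) (ρ' p.1) p.2) *
        klIntegrand ρ ρ' v v' p.1 p.2)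
  -- The bound `B` depends on `n`, so the cutoff is removed while the truncation is held fixed.
  have t3 : Tendsto (fun k : ℕ => B * (5 / ((k : ℝ) + 1)) * F) atTop (𝓝 0) := by
    have := ((tendsto_one_div_add_atTop_nhds_zero_nat (𝕜 := ℝ)).const_mul (B * 5)).mul_const F
    simp only [mul_zero, zero_mul] at this
    refine this.congr fun k => ?_
    ring
  have t4 : Tendsto (fun k => ∫ x, χ k x * truncEntropy n (ρ 1) (ρ' 1) x ∂μ -
      ∫ p in Icc 0 1 ×ˢ univ, χ k p.2 *
      (trapezoid n (logRatio (ρ p.1) (ρ' p.1) p.2) * klIntegrand ρ ρ' v v' p.1 p.2)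
        ∂((volume : Measure ℝ).prod μ)) atTop (𝓝 0) := by
    refine squeeze_zero_norm (fun k => ?_) t3
    have := hk k
    rwa [hinit] at this
  exact sub_eq_zero.1 (tendsto_nhds_unique (t1.sub t2) t4)

end TimeIntegral

end RiemKL

/-! ### The main theorem: removal of the truncation. -/

open RiemKL Filter Topology in
theorem mainTheorem2 {d : ℕ} {M : Type*} [MetricSpace M]
    [ChartedSpace (EuclideanSpace ℝ (Fin d)) M] [IsManifold (𝓡 d) ∞ M]
    [RiemannianBundle (fun x : M => TangentSpace (𝓡 d) x)]
    [IsContMDiffRiemannianBundle (𝓡 d) ∞ (EuclideanSpace ℝ (Fin d))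
      (fun x : M => TangentSpace (𝓡 d) x)]
    [IsRiemannianManifold (𝓡 d) M] [CompleteSpace M] [ConnectedSpace M] [SigmaCompactSpace M]
    [MeasurableSpace M] [BorelSpace M]
    {Ω Ω' : Type*} [MeasurableSpace Ω] [MeasurableSpace Ω']
    (ℙ : Measure Ω) [IsProbabilityMeasure ℙ] (ℙ' : Measure Ω') [IsProbabilityMeasure ℙ']
    (X : ℝ → Ω → M) (X' : ℝ → Ω' → M)
    (ρ ρ' : ℝ → M → ℝ) (v v' : ℝ → (x : M) → TangentSpace (𝓡 d) x)
    (hX : RiemKL.IsMarginalDensity d ℙ X ρ) (hX' : RiemKL.IsMarginalDensity d ℙ' X' ρ')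
    (hρ : RiemKL.IsRegularDensity (d := d) ρ) (hρ' : RiemKL.IsRegularDensity (d := d) ρ')
    (hv : RiemKL.IsTimeVectorField v) (hv' : RiemKL.IsTimeVectorField v')
    (hflux : RiemKL.FiniteFlux ρ v) (hflux' : RiemKL.FiniteFlux ρ' v')
    (htransport : RiemKL.SolvesTransport ρ v) (htransport' : RiemKL.SolvesTransport ρ' v')
    (hinit : ℙ.map (X 0) = ℙ'.map (X' 0))
    (hint : IntegrableOn
      (fun p : ℝ × M => RiemKL.klIntegrand ρ ρ' v v' p.1 p.2) (Icc 0 1 ×ˢ univ)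
      ((volume : Measure ℝ).prod (RiemKL.riemVolume d M))) :
    InformationTheory.klDiv (ℙ.map (X 1)) (ℙ'.map (X' 1)) ≠ ⊤ ∧
    (InformationTheory.klDiv (ℙ.map (X 1)) (ℙ'.map (X' 1))).toReal =
      ∫ t in (0 : ℝ)..1, ∫ x, RiemKL.klIntegrand ρ ρ' v v' t x ∂(RiemKL.riemVolume d M) := by
  have : IsContinuousRiemannianBundle (EuclideanSpace ℝ (Fin d))
      (fun x : M => TangentSpace (𝓡 d) x) := by
    obtain ⟨g, hg, hg'⟩ := IsContMDiffRiemannianBundle.exists_contMDiff (IB := 𝓡 d) (n := ∞)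
      (F := EuclideanSpace ℝ (Fin d)) (E := fun x : M => TangentSpace (𝓡 d) x)
    exact ⟨g, hg.continuous, hg'⟩
  set μ := riemVolume d M
  have m0 : (0 : ℝ) ∈ Icc (0 : ℝ) 1 := ⟨le_rfl, zero_le_one⟩
  have m1 : (1 : ℝ) ∈ Icc (0 : ℝ) 1 := ⟨zero_le_one, le_rfl⟩
  have hfin : ∀ t ∈ Icc (0 : ℝ) 1, IsFiniteMeasure (μ.withDensity fun x => ENNReal.ofReal (ρ t x)) :=
    fun t ht => by rw [← (hX t ht).2]; infer_instance
  have hfin' : ∀ t ∈ Icc (0 : ℝ) 1,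
      IsFiniteMeasure (μ.withDensity fun x => ENNReal.ofReal (ρ' t x)) :=
    fun t ht => by rw [← (hX' t ht).2]; infer_instance
  have hm : ∀ t ∈ Icc (0 : ℝ) 1, Measurable (ρ t) := fun t ht =>
    (hρ.contMDiff t ht).continuous.measurable
  have hm' : ∀ t ∈ Icc (0 : ℝ) 1, Measurable (ρ' t) := fun t ht =>
    (hρ'.contMDiff t ht).continuous.measurable
  have := hfin 1 m1
  have := hfin' 1 m1
  have : IsFiniteMeasureOnCompacts μ := isFiniteMeasureOnCompacts_of_withDensity
    (hρ.contMDiff 1 m1).continuous (hρ.pos 1 m1)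
  have h0 : ρ 0 =ᵐ[μ] ρ' 0 := by
    rw [(hX 0 m0).2, (hX' 0 m0).2, withDensity_eq_iff_of_sigmaFinite
      (hm 0 m0).ennreal_ofReal.aemeasurable (hm' 0 m0).ennreal_ofReal.aemeasurable] at hinit
    filter_upwards [hinit] with x hx
    exact (ENNReal.ofReal_eq_ofReal_iff (hρ.pos 0 m0 x).le (hρ'.pos 0 m0 x).le).1 hx
  have hn := integral_truncEntropy_eq hρ hρ'
    (integrable_of_isFiniteMeasure_withDensity (hm 1 m1) (hρ.pos 1 m1))
    (integrable_of_isFiniteMeasure_withDensity (hm' 1 m1) (hρ'.pos 1 m1)) h0 hv hv' hflux hflux'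
    htransport htransport' hint
  -- Since `0 ≤ η_n ≤ 1`, the assumed integrable function itself dominates.
  have hlim : Tendsto (fun n => ∫ p in Icc 0 1 ×ˢ univ,
      trapezoid n (logRatio (ρ p.1) (ρ' p.1) p.2) * klIntegrand ρ ρ' v v' p.1 p.2
        ∂((volume : Measure ℝ).prod μ)) atTop
      (𝓝 (∫ p in Icc 0 1 ×ˢ univ, klIntegrand ρ ρ' v v' p.1 p.2
        ∂((volume : Measure ℝ).prod μ))) := by
    refine tendsto_integral_of_dominated_convergence (fun p => ‖klIntegrand ρ ρ' v v' p.1 p.2‖)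
      (fun n => (((continuous_trapezoid n).comp_continuousOn
        (continuousOn_logRatio hρ hρ')).aestronglyMeasurable
          (measurableSet_Icc.prod .univ)).mul hint.aestronglyMeasurable) hint.norm
      (fun n => ae_of_all _ fun p => ?_) (ae_of_all _ fun p => ?_)
    · rw [norm_mul, Real.norm_eq_abs, abs_of_nonneg (trapezoid_nonneg _ _)]
      exact mul_le_of_le_one_left (norm_nonneg _) (trapezoid_le_one _ _)
    · simpa using (tendsto_trapezoid (logRatio (ρ p.1) (ρ' p.1) p.2)).mul_const
        (klIntegrand ρ ρ' v v' p.1 p.2)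
  have hE : ∀ n, truncEntropy n (ρ 1) (ρ' 1) = fun x => ρ' 1 x *
      truncKL n (Real.log (ρ 1 x) - Real.log (ρ' 1 x)) := fun n =>
    funext (truncEntropy_eq (hρ.pos 1 m1) (hρ'.pos 1 m1) n)
  obtain ⟨hI, hkl⟩ := klDiv_eq_ofReal_of_tendsto_truncKL (hm 1 m1) (hm' 1 m1) (hρ.pos 1 m1)
    (hρ'.pos 1 m1) (fun n => hE n ▸ (hn n).1)
    (hlim.congr fun n => by rw [← (hn n).2, hE n])
  have hfub : ∫ p in Icc 0 1 ×ˢ univ, klIntegrand ρ ρ' v v' p.1 p.2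
      ∂((volume : Measure ℝ).prod μ) =
      ∫ t in (0 : ℝ)..1, ∫ x, klIntegrand ρ ρ' v v' t x ∂μ := by
    unfold IntegrableOn at hint
    rw [prod_restrict_Icc_univ] at hint ⊢
    rw [integral_prod _ hint, integral_Icc_eq_integral_Ioc,
      ← intervalIntegral.integral_of_le zero_le_one]
  rw [(hX 1 m1).2, (hX' 1 m1).2, hkl, ← hfub]
  exact ⟨ENNReal.ofReal_ne_top, ENNReal.toReal_ofReal hI⟩
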